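/- Let $p,q>3$ be integers with $(p-2)(q-2)>4$, and consider the regular mosaic $\{p,q\}$ of the hyperbolic plane: its cells are $p$-gons, $q$ of them around each vertex (combinatorially, it is the coset geometry of the Coxeter group $[p,q]=\langle s_0,s_1,s_2\mid s_i^2=(s_0s_1)^p=(s_1s_2)^q=(s_0s_2)^2=1\rangle$). Fix a vertex $B_0$. Belt $0$ is $B_0$, belt $1$ consists of the cells containing $B_0$, and for $i\ge 1$ belt $i+1$ consists of the cells that have a common point with belt $i$ but none with belt $i-1$. Level $i$ is the set of vertices on the outer boundary of belt $i$ (that is, the vertices common to belts $i$ and $i+1$); level $0$ is $\{B_0\}$. All levels are finite. Build trees along the edges of the mosaic that join consecutive levels, in such a way that every vertex is joined to at most one vertex of the previous level, every vertex is joined to at least one vertex of the next level, and, subject to this, the number of edges used between any two consecutive levels is maximum. Such a system of trees exists. For any such system, let $a_i$ be the number of vertices on level $i$ that are joined to a vertex of level $i-1$ (so $a_0=0$), and let $b_i$ be the number of the remaining vertices (the roots) on level $i$ (so $b_0=1$). Then $$\lim_{i\to\infty}\frac{a_{i+1}}{a_i}=\lim_{i\to\infty}\frac{b_{i+1}}{b_i}=\lim_{i\to\infty}\frac{a_{i+1}+b_{i+1}}{a_i+b_i}=z_1,\qquad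 z_1=\frac{c+\sqrt{c^2-4}}{2},\quad c=(p-2)(q-2)-2,$$ and $z_1$ is the largest eigenvalue of the matrix $$M=\begin{pmatrix} q-3 & q-2\\ (q-3)(p-3)-1 & (q-2)(p-3)-1\end{pmatrix}.$$ -/

import Mathlib

/-!
The regular mosaic `{p,q}` with its incidence structure, the belts of cells and the layers of
vertices around a fixed vertex, and the tree graphs built layer by layer along the edges.

The mosaic is given by its symmetry group `[p,q]`, generated by the reflections `s₀, s₁, s₂` in
the sides of a characteristic triangle, which is the Coxeter group with the relations
`(s₀s₁)^p = (s₁s₂)^q = (s₀s₂)^2 = 1`. It acts simply transitively on the flags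
(vertex, edge, cell) of the mosaic, so that flags are elements of the group, and vertices, edges
and cells are the left cosets of the stabilizers of those of the base flag; a vertex lies on an
edge or a cell if they share a flag.
-/

/-- The Coxeter matrix of the group `[p,q]` of the regular mosaic `{p,q}`. -/
def schlafliMatrix (p q : ℕ) (hp : 3 ≤ p) (hq : 3 ≤ q) : CoxeterMatrix (Fin 3) where
  M := !![1, p, 2; p, 1, q; 2, q, 1]
  isSymm := by
    ext i j
    fin_cases i <;> fin_cases j <;> rfl
  diagonal i := by
    fin_cases i <;> rfl
  off_diagonal i j h := by
    fin_cases i <;> fin_cases j <;> simp at h ⊢ <;> omega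

namespace Mosaic

/-- Vertices: cosets of the stabilizer `⟨s₁, s₂⟩` of the base vertex. -/
def Vertex (M : CoxeterMatrix (Fin 3)) : Type :=
  M.Group ⧸ Subgroup.closure {M.simple 1, M.simple 2}

/-- Edges: cosets of the stabilizer `⟨s₀, s₂⟩` of the base edge. -/
def Edge (M : CoxeterMatrix (Fin 3)) : Type :=
  M.Group ⧸ Subgroup.closure {M.simple 0, M.simple 2}

/-- Cells: cosets of the stabilizer `⟨s₀, s₁⟩` of the base cell. -/
def Cell (M : CoxeterMatrix (Fin 3)) : Type :=
  M.Group ⧸ Subgroup.closure {M.simple 0, M.simple 1}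

variable {M : CoxeterMatrix (Fin 3)}

/-- The vertex of a flag. -/
def vertexOf (g : M.Group) : Vertex M := QuotientGroup.mk g

/-- The edge of a flag. -/
def edgeOf (g : M.Group) : Edge M := QuotientGroup.mk g

/-- The cell of a flag. -/
def cellOf (g : M.Group) : Cell M := QuotientGroup.mk g

/-- The vertex `v` is an endpoint of the edge `e`. -/
def OnEdge (v : Vertex M) (e : Edge M) : Prop := ∃ g : M.Group, vertexOf g = v ∧ edgeOf g = e

/-- The vertex `v` is a vertex of the cell `c`. -/
def OnCell (v : Vertex M) (c : Cell M) : Prop := ∃ g : M.Group, vertexOf g = v ∧ cellOf g = c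

variable (M) in
/-- The lattice: the graph of the vertices and edges of the mosaic. -/
def lattice : SimpleGraph (Vertex M) where
  Adj v w := v ≠ w ∧ ∃ e : Edge M, OnEdge v e ∧ OnEdge w e
  symm := ⟨fun _ _ h => ⟨h.1.symm, h.2.imp fun _ he => he.symm⟩⟩
  loopless := ⟨fun _ h => h.1 rfl⟩

/-- The cell `c` has a vertex in `S`. (A common point of two cells of the mosaic is a vertex, or
it lies on an edge of both, whose endpoints are then common vertices.) -/
def Meets (c : Cell M) (S : Set (Vertex M)) : Prop := ∃ v ∈ S, OnCell v c

/-- All vertices of a set of cells. -/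
def verticesOf (C : Set (Cell M)) : Set (Vertex M) := {v | ∃ c ∈ C, OnCell v c}

/-- The vertices of belt `i` around the vertex `o`. Belt `0` is `o`, belt `1` consists of the cells
that meet `o`, and belt `i + 1` of the cells that meet belt `i` but not belt `i - 1`. -/
def beltVertices (o : Vertex M) : ℕ → Set (Vertex M)
  | 0 => {o}
  | 1 => verticesOf {c | Meets c {o}}
  | n + 2 => verticesOf {c | Meets c (beltVertices o (n + 1)) ∧ ¬ Meets c (beltVertices o n)}

/-- Layer (level) `i`: the outer boundary of belt `i`, that is, the vertices it shares with
belt `i + 1`. -/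
def layer (o : Vertex M) (i : ℕ) : Set (Vertex M) := beltVertices o i ∩ beltVertices o (i + 1)

/-- The edges of the graph `T` from level `i` to level `i + 1`. -/
def links (o : Vertex M) (T : SimpleGraph (Vertex M)) (i : ℕ) : Set (Vertex M × Vertex M) :=
  {e | e.1 ∈ layer o i ∧ e.2 ∈ layer o (i + 1) ∧ T.Adj e.1 e.2}

/-- `T` consists of lattice edges between consecutive levels, it connects every vertex to at most
one vertex of the previous level, and it has no leaves: every vertex of a level is connected to
the next level. -/
structure IsLayered (o : Vertex M) (T : SimpleGraph (Vertex M)) : Prop where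
  le_lattice : T ≤ lattice M
  consecutive : ∀ u v, T.Adj u v → ∃ i, (u, v) ∈ links o T i ∨ (v, u) ∈ links o T i
  parent_unique : ∀ i u u' v, (u, v) ∈ links o T i → (u', v) ∈ links o T i → u = u'
  no_leaves : ∀ i, ∀ u ∈ layer o i, ∃ v, (u, v) ∈ links o T i

/-- `T` is the graph of the trees: between any two consecutive levels it has the maximum number of
edges. -/
structure IsForest (o : Vertex M) (T : SimpleGraph (Vertex M)) : Prop extends IsLayered o T where
  maximum : ∀ T', IsLayered o T' → ∀ i, (links o T' i).encard ≤ (links o T i).encard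

/-- The vertices `A` on level `i`: those connected to a vertex of the previous level. -/
def nonRoots (o : Vertex M) (T : SimpleGraph (Vertex M)) (i : ℕ) : Set (Vertex M) :=
  {v | v ∈ layer o i ∧ ∃ j, j + 1 = i ∧ ∃ u, (u, v) ∈ links o T j}

/-- The roots `B` on level `i`: all the other vertices of the level. -/
def roots (o : Vertex M) (T : SimpleGraph (Vertex M)) (i : ℕ) : Set (Vertex M) :=
  layer o i \ nonRoots o T i

/-- The number `a_i` of vertices `A` on level `i`. -/
noncomputable def a (o : Vertex M) (T : SimpleGraph (Vertex M)) (i : ℕ) : ℕ :=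
  (nonRoots o T i).ncard

/-- The number `b_i` of roots `B` on level `i`. -/
noncomputable def b (o : Vertex M) (T : SimpleGraph (Vertex M)) (i : ℕ) : ℕ :=
  (roots o T i).ncard

/-- The recursion matrix of the pairs `(a_i, b_i)`. -/
def recursionMatrix (p q : ℕ) : Matrix (Fin 2) (Fin 2) ℝ :=
  !![(q : ℝ) - 3, (q : ℝ) - 2;
    ((q : ℝ) - 3) * ((p : ℝ) - 3) - 1, ((q : ℝ) - 2) * ((p : ℝ) - 3) - 1]

/-- The number `c = (p - 2)(q - 2) - 2`. -/
def c (p q : ℕ) : ℝ := ((p : ℝ) - 2) * ((q : ℝ) - 2) - 2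

/-- The number `z₁ = (c + √(c² - 4)) / 2`. -/
noncomputable def z₁ (p q : ℕ) : ℝ := (c p q + √((c p q) ^ 2 - 4)) / 2

end Mosaic

/-!
The vertices of the mosaic are given explicit addresses. Around a vertex off level `0`, the edges
lead, in this order, possibly to the previous level, to the preceding vertex of the same level, to
`q - 3` or `q - 2` vertices of the next level, and to the following vertex of the same level. So the
vertices of level `i + 1` are obtained from those of level `i` like the children in an ordered tree:
every edge to level `i + 1` brings its end and the vertices between the end of the preceding edge
and its own end, which are `p - 3` if both edges start at the same vertex and `p - 4` otherwise.
An address (`Address`, `Address.Valid`) is a path in this tree, and the cyclic order on the levels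
(`Address.pred`, `Address.succ`) is defined by recursion.

That this describes the coset geometry of `[p,q]` is shown as follows. The darts (directed edges) of
the addresses carry a rotation `ρ` around the vertices and a reversal `ι` (`Address.opp`), and
`(ι * ρ) ^ p = 1`, because every cell contains an edge between two levels, and from there one can
follow its boundary (`faceStep_iterate_child`, `exists_iterate_faceStep`). Hence the Coxeter group
acts on the flags of this map (`flagPerm_isLiftable`). Conversely, every address spells a group
element (`label`), and these elements turn adjacent flags into elements that differ by a generator
(`label_opp`, `ofFlag_flagMap`). The two maps are inverse to each other, so the group acts simply
transitively on the flags (`ofFlag_bijective`); vertices, edges and cells as cosets become vertices,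
edges and cells of the addresses (`exists_addressing`).

The cells of belt `i` are then those with vertices on the levels `i - 1` and `i`, so that the levels
of the theorem are those of the addresses (`beltVertices_eq`, `layer_eq`). Every vertex has at most
one neighbour on the previous level, so the trees consist of all edges between consecutive levels
(`levelGraph_isForest`, `nonRoots_eq`), and `a_i`, `b_i` count addresses. From level `1` on,
`a_{i+1} = (q-3) a_i + (q-2) b_i` and `a_{i+1} + b_{i+1} + a_i + b_i = (p-2) a_{i+1}`, so that the
recursion `x_{i+2} = c x_{i+1} - x_i` holds for both sequences. Its characteristic polynomial is that
of the matrix `M`, with the roots `z₁ > 1 > 1 / z₁` (`tendsto_ratio`).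
-/

namespace Mosaic

/-! ### Addresses of vertices -/

/-- Names for the vertices of the mosaic. A vertex `v` has consecutive edges to the next level,
numbered by `k`. The vertices of the next level that follow the end of edge `k - 1` of `v` (for
`k = 0`, the end of the last edge of the preceding vertex) up to the end of edge `k` are named
`node v k j`, where `j` is the number of steps along the level from `node v k j` to the end
`node v k 0` of edge `k`. -/
inductive Address : Type
  | root : Address
  | node (v : Address) (k j : ℕ) : Address
  deriving DecidableEq

namespace Address

/-- The level of a vertex. -/
def level : Address → ℕ
  | root => 0
  | node v _ _ => v.level + 1

/-- The number of edges from a vertex to the next level. -/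
def outdeg (q : ℕ) : Address → ℕ
  | root => q
  | node _ _ 0 => q - 3
  | node _ _ (_ + 1) => q - 2

/-- The number of vertices strictly between the ends of the edges `k - 1` and `k` of a vertex, on
the cell between these edges. For `k = 0` this cell has two vertices on the lower level instead
of one, except at the root. -/
def gap (p : ℕ) : Address → ℕ → ℕ
  | root, _ => p - 3
  | node _ _ _, 0 => p - 4
  | node _ _ _, _ + 1 => p - 3

/-- The direction of edge `0` to the next level. At a vertex off the root, the directions `0` and
`1` are taken by edges to the same or to the previous level. -/
def base : Address → ℕ
  | root => 0
  | node _ _ _ => 2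

/-- The addresses that name vertices of the mosaic `{p,q}`. -/
def Valid (p q : ℕ) : Address → Prop
  | root => True
  | node v k j => v.Valid p q ∧ k < v.outdeg q ∧ j ≤ v.gap p k

/-- The preceding vertex in the cyclic order of a level. -/
def pred (p q : ℕ) : Address → Address
  | root => root
  | node v k j =>
    if j < v.gap p k then node v k (j + 1)
    else match k with
      | 0 => node (v.pred p q) ((v.pred p q).outdeg q - 1) 0
      | k + 1 => node v k 0

/-- The following vertex in the cyclic order of a level. -/
def succ (p q : ℕ) : Address → Address
  | root => root
  | node v k (j + 1) => node v k j
  | node v k 0 =>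
    if k + 1 < v.outdeg q then node v (k + 1) (v.gap p (k + 1))
    else node (v.succ p q) 0 ((v.succ p q).gap p 0)

variable {p q : ℕ}

lemma outdeg_pos (hq : 3 < q) (v : Address) : 0 < v.outdeg q := by
  rcases v with _ | ⟨v, k, _ | j⟩ <;> simp only [outdeg] <;> omega

lemma pred_of_lt {v : Address} {k j : ℕ} (h : j < v.gap p k) :
    (node v k j).pred p q = node v k (j + 1) := by
  cases k <;> simp only [pred, if_pos h]

lemma pred_gap_zero (v : Address) :
    (node v 0 (v.gap p 0)).pred p q = node (v.pred p q) ((v.pred p q).outdeg q - 1) 0 := by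
  simp only [pred, lt_irrefl, if_false]

lemma pred_gap_succ (v : Address) (k : ℕ) :
    (node v (k + 1) (v.gap p (k + 1))).pred p q = node v k 0 := by
  simp only [pred, lt_irrefl, if_false]

lemma succ_of_lt {v : Address} {k : ℕ} (h : k + 1 < v.outdeg q) :
    (node v k 0).succ p q = node v (k + 1) (v.gap p (k + 1)) := by
  simp only [succ, if_pos h]

lemma succ_last {v : Address} {k : ℕ} (h : k + 1 = v.outdeg q) :
    (node v k 0).succ p q = node (v.succ p q) 0 ((v.succ p q).gap p 0) := by
  simp only [succ, h, lt_irrefl, if_false]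

@[simp] lemma level_pred (v : Address) : (v.pred p q).level = v.level := by
  induction v with
  | root => rfl
  | node v k j ih =>
    rcases k with _ | k <;> simp only [pred] <;> split_ifs <;> simp [level, ih]

@[simp] lemma level_succ (v : Address) : (v.succ p q).level = v.level := by
  induction v with
  | root => rfl
  | node v k j ih =>
    rcases j with _ | j <;> simp only [succ]
    · split_ifs <;> simp [level, ih]
    · simp [level]

lemma Valid.pred (hq : 3 < q) {v : Address} (hv : v.Valid p q) : (v.pred p q).Valid p q := by
  induction v with
  | root => trivial
  | node v k j ih =>
    obtain ⟨h, hk, hj⟩ := hv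
    rcases hj.lt_or_eq with hj | rfl
    · rw [pred_of_lt hj]
      exact ⟨h, hk, hj⟩
    · rcases k with _ | k
      · rw [pred_gap_zero]
        have := outdeg_pos hq (v.pred p q)
        exact ⟨ih h, by omega, Nat.zero_le _⟩
      · rw [pred_gap_succ]
        exact ⟨h, by omega, Nat.zero_le _⟩

lemma Valid.succ (hq : 3 < q) {v : Address} (hv : v.Valid p q) : (v.succ p q).Valid p q := by
  induction v with
  | root => trivial
  | node v k j ih =>
    obtain ⟨h, hk, hj⟩ := hv
    rcases j with _ | j
    · rcases (Nat.succ_le_of_lt hk).lt_or_eq with hk | hk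
      · rw [succ_of_lt hk]
        exact ⟨h, hk, le_rfl⟩
      · rw [succ_last hk]
        exact ⟨ih h, outdeg_pos hq _, le_rfl⟩
    · exact ⟨h, hk, by omega⟩

lemma pred_succ {v : Address} (hv : v.Valid p q) : (v.succ p q).pred p q = v := by
  induction v with
  | root => rfl
  | node v k j ih =>
    obtain ⟨h, hk, hj⟩ := hv
    rcases j with _ | j
    · rcases (Nat.succ_le_of_lt hk).lt_or_eq with hk | hk
      · rw [succ_of_lt hk, pred_gap_succ]
      · rw [succ_last hk, pred_gap_zero, ih h, ← hk, Nat.succ_sub_one]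
    · exact pred_of_lt hj

lemma succ_pred (hq : 3 < q) {v : Address} (hv : v.Valid p q) :
    (v.pred p q).succ p q = v := by
  induction v with
  | root => rfl
  | node v k j ih =>
    obtain ⟨h, hk, hj⟩ := hv
    rcases hj.lt_or_eq with hj | rfl
    · rw [pred_of_lt hj, succ]
    · rcases k with _ | k
      · have := outdeg_pos hq (v.pred p q)
        rw [pred_gap_zero, succ_last (by omega), ih h]
      · rw [pred_gap_succ, succ_of_lt hk]

lemma pred_ne_root {v : Address} (hv : v ≠ root) : v.pred p q ≠ root := by
  intro h
  have := congrArg level h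
  rw [level_pred] at this
  cases v
  · exact hv rfl
  · simp [level] at this

lemma succ_ne_root {v : Address} (hv : v ≠ root) : v.succ p q ≠ root := by
  intro h
  have := congrArg level h
  rw [level_succ] at this
  cases v
  · exact hv rfl
  · simp [level] at this

lemma base_of_ne {v : Address} (hv : v ≠ root) : v.base = 2 := by
  cases v
  · exact absurd rfl hv
  · rfl

/-! ### Darts -/

/-- The reversal of darts. The dart `(v, d)` starts at `v` and points in direction `d`, where the
directions around a vertex run counterclockwise through `ZMod q`. Off the root, direction `1` points to the
preceding vertex of the level, the directions from `2` on point to the next level, and the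
direction after these points to the following vertex of the level; if `v` is the end of an edge
from the previous level, this edge has direction `0`. -/
def opp (p q : ℕ) : Address → ZMod q → Address × ZMod q
  | root, d => (node root d.val 0, 0)
  | node v k j, d =>
    if d = 1 then
      ((node v k j).pred p q, (((node v k j).pred p q).outdeg q + 2 : ℕ))
    else if j = 0 ∧ d = 0 then (v, (v.base + k : ℕ))
    else if 2 ≤ d.val ∧ d.val - 2 < (node v k j).outdeg q then
      (node (node v k j) (d.val - 2) 0, 0)
    else ((node v k j).succ p q, 1)

/-- The four kinds of darts: to the next level, to the preceding and to the following vertex of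
the level, and to the previous level. -/
inductive Kind (q : ℕ) : Address → ZMod q → Prop
  | out (v : Address) (k : ℕ) (hk : k < v.outdeg q) : Kind q v (v.base + k : ℕ)
  | prev (v : Address) (hv : v ≠ root) : Kind q v 1
  | next (v : Address) (hv : v ≠ root) : Kind q v (v.outdeg q + 2 : ℕ)
  | down (v : Address) (k : ℕ) : Kind q (node v k 0) 0

lemma outdeg_add_two_le (hq : 3 < q) {v : Address} (hv : v ≠ root) : v.outdeg q + 2 ≤ q := by
  rcases v with _ | ⟨v, k, _ | j⟩
  · exact absurd rfl hv
  all_goals simp only [outdeg]; omega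

lemma kind (hq : 3 < q) (v : Address) (d : ZMod q) : Kind q v d := by
  have : NeZero q := ⟨by omega⟩
  obtain ⟨n, hn, rfl⟩ : ∃ n < q, (n : ZMod q) = d := ⟨d.val, d.val_lt, ZMod.natCast_zmod_val d⟩
  rcases v with _ | ⟨v, k, j⟩
  · simpa [base] using Kind.out root n hn
  · have hne : node v k j ≠ root := by simp
    by_cases h1 : n = 1
    · subst h1
      simpa using Kind.prev _ hne
    by_cases h0 : n = 0
    · subst h0
      rcases j with _ | j
      · simpa using Kind.down v k
      · have h := Kind.next (q := q) _ hne
        have hq' : (node v k (j + 1)).outdeg q + 2 = q := by simp only [outdeg]; omega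
        rw [hq'] at h
        simpa using h
    by_cases h2 : n - 2 < (node v k j).outdeg q
    · have h := Kind.out _ _ h2
      have h3 : (node v k j).base + (n - 2) = n := by simp only [base]; omega
      rwa [h3] at h
    · have h := Kind.next (q := q) _ hne
      have h3 : (node v k j).outdeg q + 2 = n := by
        have := outdeg_add_two_le hq hne
        rcases j with _ | j <;> simp only [outdeg] at * <;> omega
      rwa [h3] at h

lemma opp_out (hq : 3 < q) {v : Address} {k : ℕ} (hk : k < v.outdeg q) :
    opp p q v (v.base + k : ℕ) = (node v k 0, 0) := by
  rcases v with _ | ⟨u, l, j⟩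
  · have hk' : k < q := hk
    rw [show root.base + k = k from zero_add k, opp, ZMod.val_natCast_of_lt hk']
  · have h2 := outdeg_add_two_le hq (v := node u l j) (by simp)
    have hv : ((2 + k : ℕ) : ZMod q).val = 2 + k := ZMod.val_natCast_of_lt (by omega)
    have hne1 : ((2 + k : ℕ) : ZMod q) ≠ 1 := fun h => by
      rw [h, ZMod.val_one'' (by omega)] at hv
      omega
    have hne0 : ((2 + k : ℕ) : ZMod q) ≠ 0 := fun h => by
      rw [h, ZMod.val_zero] at hv
      omega
    rw [show (node u l j).base + k = 2 + k from rfl, opp, if_neg hne1,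
      if_neg (fun h => hne0 h.2), hv, if_pos ⟨by omega, by omega⟩, Nat.add_sub_cancel_left]

lemma opp_prev {v : Address} (hv : v ≠ root) :
    opp p q v 1 = (v.pred p q, (((v.pred p q).outdeg q + 2 : ℕ) : ZMod q)) := by
  cases v
  · exact absurd rfl hv
  · simp only [opp, if_true]

lemma opp_next (hq : 3 < q) {v : Address} (hv : v ≠ root) :
    opp p q v (v.outdeg q + 2 : ℕ) = (v.succ p q, 1) := by
  rcases v with _ | ⟨u, l, _ | j⟩
  · exact absurd rfl hv
  · have hm : (node u l 0).outdeg q + 2 = q - 1 := by simp only [outdeg]; omega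
    have hv : ((q - 1 : ℕ) : ZMod q).val = q - 1 := ZMod.val_natCast_of_lt (by omega)
    have hne1 : ((q - 1 : ℕ) : ZMod q) ≠ 1 := fun h => by
      rw [h, ZMod.val_one'' (by omega)] at hv
      omega
    have hne0 : ((q - 1 : ℕ) : ZMod q) ≠ 0 := fun h => by
      rw [h, ZMod.val_zero] at hv
      omega
    rw [hm, opp, if_neg hne1, if_neg (fun h => hne0 h.2), hv, if_neg (by omega)]
  · have hm : (node u l (j + 1)).outdeg q + 2 = q := by simp only [outdeg]; omega
    have hne : (0 : ZMod q) ≠ 1 := fun h => by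
      have := congrArg ZMod.val h
      rw [ZMod.val_zero, ZMod.val_one'' (by omega)] at this
      omega
    rw [hm, ZMod.natCast_self, opp, if_neg hne, if_neg (by simp), if_neg (by simp)]

lemma opp_down (hq : 3 < q) (v : Address) (k : ℕ) :
    opp p q (node v k 0) 0 = (v, ((v.base + k : ℕ) : ZMod q)) := by
  have hne : (0 : ZMod q) ≠ 1 := fun h => by
    have := congrArg ZMod.val h
    rw [ZMod.val_zero, ZMod.val_one'' (by omega)] at this
    omega
  simp [opp, hne]

lemma Valid.opp (hq : 3 < q) {v : Address} (hv : v.Valid p q) (d : ZMod q) :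
    (opp p q v d).1.Valid p q := by
  cases kind hq v d with
  | out v k hk => rw [opp_out hq hk]; exact ⟨hv, hk, Nat.zero_le _⟩
  | prev v h => rw [opp_prev h]; exact hv.pred hq
  | next v h => rw [opp_next hq h]; exact hv.succ hq
  | down v k => rw [opp_down hq]; exact hv.1

lemma opp_opp (hq : 3 < q) {v : Address} (hv : v.Valid p q) (d : ZMod q) :
    Address.opp p q (Address.opp p q v d).1 (Address.opp p q v d).2 = (v, d) := by
  cases kind hq v d with
  | out v k hk => rw [opp_out hq hk, opp_down hq]
  | prev v h => rw [opp_prev h, opp_next hq (pred_ne_root h), succ_pred hq hv]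
  | next v h => rw [opp_next hq h, opp_prev (succ_ne_root h), pred_succ hv]
  | down v k => rw [opp_down hq, opp_out hq hv.2.1]

end Address

section

open Address

variable {p q : ℕ}

/-! ### Cells -/

/-- The next dart along the boundary of the cell to the left of a dart, in clockwise order: turn
around the vertex, then reverse. -/
def faceStep (p q : ℕ) (x : Address × ZMod q) : Address × ZMod q := opp p q x.1 (x.2 + 1)

/-- From the end of an edge, the boundary of the cell before this edge first leads back along the
level. -/
lemma faceStep_iterate_descent (hq : 3 < q) (u : Address) (k : ℕ) {i : ℕ} (hi : i ≤ u.gap p k) :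
    (faceStep p q)^[i + 1] (node u k 0, 0) =
      ((node u k i).pred p q, ((((node u k i).pred p q).outdeg q + 2 : ℕ) : ZMod q)) := by
  induction i with
  | zero =>
    rw [zero_add, Function.iterate_one, faceStep, zero_add, opp_prev (by simp)]
  | succ i ih =>
    rw [Function.iterate_succ_apply', ih (by omega), pred_of_lt (by omega), faceStep]
    have h : (node u k (i + 1)).outdeg q + 2 = q := by simp only [outdeg]; omega
    rw [h, ZMod.natCast_self, zero_add, opp_prev (by simp)]

/-- At the end of an edge from the previous level, the direction `0` of this edge comes after the
direction to the following vertex. -/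
lemma outdeg_child (hq : 3 < q) (u : Address) (k : ℕ) :
    (((node u k 0).outdeg q + 2 : ℕ) : ZMod q) + 1 = 0 := by
  have h : (node u k 0).outdeg q + 2 + 1 = q := by simp only [outdeg]; omega
  rw [← Nat.cast_add_one, h, ZMod.natCast_self]

lemma faceStep_iterate_zero (hq : 3 < q) (u : Address) :
    (faceStep p q)^[u.gap p 0 + 2] (node u 0 0, 0) =
      (u.pred p q, (((u.pred p q).base + ((u.pred p q).outdeg q - 1) : ℕ) : ZMod q)) := by
  rw [Function.iterate_succ_apply', faceStep_iterate_descent hq u 0 le_rfl, pred_gap_zero, faceStep,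
    outdeg_child hq, opp_down hq]

lemma faceStep_iterate_succ (hq : 3 < q) (u : Address) (k : ℕ) :
    (faceStep p q)^[u.gap p (k + 1) + 2] (node u (k + 1) 0, 0) =
      (u, ((u.base + k : ℕ) : ZMod q)) := by
  rw [Function.iterate_succ_apply', faceStep_iterate_descent hq u (k + 1) le_rfl, pred_gap_succ,
    faceStep, outdeg_child hq, opp_down hq]

lemma faceStep_iterate_prev (hq : 3 < q) {u : Address} (hu : u ≠ root) (hv : u.Valid p q) :
    (faceStep p q)^[u.gap p 0 + 3] (node u 0 0, 0) = (u, 1) := by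
  have hne := pred_ne_root (p := p) (q := q) hu
  have hm := outdeg_pos hq (u.pred p q)
  rw [Function.iterate_succ_apply', faceStep_iterate_zero hq, faceStep, ← Nat.cast_add_one,
    base_of_ne hne,
    show 2 + ((u.pred p q).outdeg q - 1) + 1 = (u.pred p q).outdeg q + 2 by omega,
    opp_next hq hne, succ_pred hq hv]

/-- Every cell has `p` sides. -/
lemma faceStep_iterate_child (hp : 3 < p) (hq : 3 < q) {u : Address} {k : ℕ}
    (hv : (node u k 0).Valid p q) : (faceStep p q)^[p] (node u k 0, 0) = (node u k 0, 0) := by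
  obtain ⟨hu, hk, -⟩ := hv
  rcases k with _ | k
  · by_cases hr : u = root
    · subst hr
      have h : root.gap p 0 + 2 + 1 = p := by simp only [gap]; omega
      have h0 : (((root.base + (root.outdeg q - 1) : ℕ) : ZMod q) + 1)
          = ((root.base + 0 : ℕ) : ZMod q) := by
        have : root.base + (root.outdeg q - 1) + 1 = q := by simp only [base, outdeg]; omega
        rw [← Nat.cast_add_one, this, ZMod.natCast_self]
        simp [base]
      refine .trans (b := (faceStep p q)^[root.gap p 0 + 2 + 1] _) (by rw [h]) ?_
      rw [Function.iterate_succ_apply', faceStep_iterate_zero hq, faceStep, pred, h0, opp_out hq hk]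
    · have h : u.gap p 0 + 3 + 1 = p := by
        cases u
        · exact absurd rfl hr
        · simp only [gap]; omega
      have h1 : (1 + 1 : ZMod q) = ((u.base + 0 : ℕ) : ZMod q) := by
        rw [base_of_ne hr, add_zero, Nat.cast_ofNat, one_add_one_eq_two]
      refine .trans (b := (faceStep p q)^[u.gap p 0 + 3 + 1] _) (by rw [h]) ?_
      rw [Function.iterate_succ_apply', faceStep_iterate_prev hq hr hu, faceStep, h1, opp_out hq hk]
  · have h : u.gap p (k + 1) + 2 + 1 = p := by
      cases u <;> simp only [gap] <;> omega
    refine .trans (b := (faceStep p q)^[u.gap p (k + 1) + 2 + 1] _) (by rw [h]) ?_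
    rw [Function.iterate_succ_apply', faceStep_iterate_succ hq, faceStep, ← Nat.cast_add_one,
      add_assoc, opp_out hq hk]

/-- Every cell contains the end of an edge between two levels. -/
lemma exists_iterate_faceStep (hq : 3 < q) {v : Address} (hv : v.Valid p q) (d : ZMod q) :
    ∃ u k i, (node u k 0).Valid p q ∧ (faceStep p q)^[i] (node u k 0, 0) = (v, d) := by
  cases kind hq v d with
  | out v k hk =>
    rcases (Nat.succ_le_of_lt hk).lt_or_eq with hk' | hk'
    · exact ⟨v, k + 1, _, ⟨hv, hk', Nat.zero_le _⟩, faceStep_iterate_succ hq v k⟩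
    · refine ⟨v.succ p q, 0, _, ⟨hv.succ hq, outdeg_pos hq _, Nat.zero_le _⟩,
        (faceStep_iterate_zero hq _).trans ?_⟩
      rw [pred_succ hv, ← hk', Nat.succ_sub_one]
  | prev v h =>
    exact ⟨v, 0, _, ⟨hv, outdeg_pos hq v, Nat.zero_le _⟩, faceStep_iterate_prev hq h hv⟩
  | next v h =>
    have hs := hv.succ hq
    have hp := pred_succ hv
    have hne := succ_ne_root (p := p) (q := q) h
    generalize v.succ p q = s at hs hp hne
    rcases s with _ | ⟨u, k, j⟩
    · exact absurd rfl hne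
    · refine ⟨u, k, j + 1, ⟨hs.1, hs.2.1, Nat.zero_le _⟩, ?_⟩
      rw [faceStep_iterate_descent hq u k hs.2.2, hp]
  | down v k => exact ⟨v, k, 0, hv, rfl⟩

/-- The level of the cell to the left of a dart, that is, the higher one of the two levels of its
vertices. -/
def cellLevel (x : Address × ZMod q) : ℕ :=
  if x.1 ≠ root ∧ (x.2 = 0 ∨ x.2 = (x.1.outdeg q + 2 : ℕ)) then x.1.level else x.1.level + 1

lemma cellLevel_of_lt (hq : 3 < q) {v : Address} {i : ℕ} (h0 : 0 < i)
    (hi : i < v.outdeg q + 2) : cellLevel (v, (i : ZMod q)) = v.level + 1 := by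
  refine if_neg fun ⟨hv, h⟩ => ?_
  have hm : v.outdeg q + 2 ≤ q := outdeg_add_two_le hq hv
  have hval : ((i : ℕ) : ZMod q).val = i := ZMod.val_natCast_of_lt (by omega)
  rcases h with h | h
  · simp only at h
    rw [h, ZMod.val_zero] at hval
    omega
  · simp only at h
    rw [h, ZMod.val_natCast] at hval
    rcases hm.lt_or_eq with hm | hm
    · rw [Nat.mod_eq_of_lt hm] at hval
      omega
    · rw [hm, Nat.mod_self] at hval
      omega

lemma cellLevel_root (d : ZMod q) : cellLevel (root, d) = 1 := if_neg fun h => h.1 rfl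

lemma cellLevel_opp (hq : 3 < q) {v : Address} (hval : v.Valid p q) (d : ZMod q) :
    cellLevel (opp p q v d) = cellLevel (v, d - 1) := by
  cases kind hq v d with
  | out v k hk =>
    rw [opp_out hq hk]
    have h1 : cellLevel (node v k 0, (0 : ZMod q)) = v.level + 1 := if_pos ⟨by simp, Or.inl rfl⟩
    rw [h1]
    by_cases hv : v = root
    · rw [hv, cellLevel_root]
      rfl
    · rw [base_of_ne hv, show 2 + k = (1 + k) + 1 by omega, Nat.cast_add_one, add_sub_cancel_right,
        cellLevel_of_lt hq (by omega) (by omega)]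
  | prev v h =>
    rw [opp_prev h, sub_self]
    have h1 : cellLevel (v, (0 : ZMod q)) = v.level := if_pos ⟨h, Or.inl rfl⟩
    rw [h1]
    exact (if_pos ⟨pred_ne_root h, Or.inr rfl⟩).trans (level_pred v)
  | next v h =>
    have := outdeg_pos hq (v.succ p q)
    rw [opp_next hq h, show v.outdeg q + 2 = (v.outdeg q + 1) + 1 from rfl, Nat.cast_add_one,
      add_sub_cancel_right, cellLevel_of_lt hq (by omega) (by omega), ← Nat.cast_one,
      cellLevel_of_lt hq one_pos (by omega), level_succ]
  | down v k =>
    rw [opp_down hq, zero_sub]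
    have h1 : cellLevel (node v k 0, (-1 : ZMod q)) = v.level + 1 :=
      if_pos ⟨by simp, Or.inr (eq_neg_of_add_eq_zero_left (outdeg_child hq v k)).symm⟩
    rw [h1]
    by_cases hv : v = root
    · rw [hv, cellLevel_root]
      rfl
    · have hk := hval.2.1
      rw [base_of_ne hv, cellLevel_of_lt hq (by omega) (by omega)]

end

section

open Address Equiv

/-! ### The flags of an oriented map -/

section Flags

variable {D : Type*}

/-- The action of the generators `s₀, s₁, s₂` on the flags of an oriented map. The map is given by
its darts, the rotation `ρ` around the vertices and the reversal `ι`; the flags `(x, true)` and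
`(x, false)` consist of the vertex and the edge of the dart `x` and the cell to the left and to
the right of `x`. -/
def flagMap (ρ ι : Perm D) : Fin 3 → D × Bool → D × Bool
  | 0, (x, ε) => (ι x, !ε)
  | 1, (x, true) => (ρ x, false)
  | 1, (x, false) => (ρ⁻¹ x, true)
  | 2, (x, ε) => (x, !ε)

lemma flagMap_involutive (ρ : Perm D) {ι : Perm D} (hι : ι * ι = 1) (i : Fin 3) :
    Function.Involutive (flagMap ρ ι i) := by
  have h : ∀ x, ι (ι x) = x := fun x => by rw [← Perm.mul_apply, hι, Perm.one_apply]
  rintro ⟨x, ε⟩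
  fin_cases i <;> cases ε <;> simp [flagMap, h]

/-- The permutations of the flags by the generators. -/
def flagPerm (ρ : Perm D) {ι : Perm D} (hι : ι * ι = 1) (i : Fin 3) : Perm (D × Bool) :=
  (flagMap_involutive ρ hι i).toPerm

lemma flagPerm_mul_self (ρ : Perm D) {ι : Perm D} (hι : ι * ι = 1) (i : Fin 3) :
    flagPerm ρ hι i * flagPerm ρ hι i = 1 :=
  Equiv.ext fun x => flagMap_involutive ρ hι i x

lemma pow_apply_of_forall {σ : Perm (D × Bool)} {α β : Perm D}
    (h1 : ∀ x, σ (x, true) = (α x, true)) (h2 : ∀ x, σ (x, false) = (β x, false)) {n : ℕ}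
    (hα : α ^ n = 1) (hβ : β ^ n = 1) : σ ^ n = 1 := by
  have h : ∀ m : ℕ, ∀ x, (σ ^ m) (x, true) = ((α ^ m) x, true) ∧
      (σ ^ m) (x, false) = ((β ^ m) x, false) := by
    intro m
    induction m with
    | zero => simp
    | succ m ih => intro x; simp [pow_succ, h1, h2, ih]
  ext1 ⟨x, ε⟩
  cases ε
  · rw [(h n x).2, hβ]; rfl
  · rw [(h n x).1, hα]; rfl

variable {p q : ℕ} (hp : 3 ≤ p) (hq : 3 ≤ q)

/-- An oriented map with `p`-gonal cells and vertices of degree `q` satisfies the relations of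
`[p,q]`. -/
lemma flagPerm_isLiftable {ρ ι : Perm D} (hι : ι * ι = 1) (hρ : ρ ^ q = 1) (hf : (ι * ρ) ^ p = 1) :
    (schlafliMatrix p q hp hq).IsLiftable (flagPerm ρ hι) := by
  have hinv : ι⁻¹ = ι := inv_eq_of_mul_eq_one_left hι
  have swap : ∀ i j n, (flagPerm ρ hι i * flagPerm ρ hι j) ^ n = 1 →
      (flagPerm ρ hι j * flagPerm ρ hι i) ^ n = 1 := by
    intro i j n h
    have hi : ∀ i, (flagPerm ρ hι i)⁻¹ = flagPerm ρ hι i := fun i =>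
      inv_eq_of_mul_eq_one_left (flagPerm_mul_self ρ hι i)
    rw [← hi i, ← hi j, ← mul_inv_rev, inv_pow, h, inv_one]
  have h01 : (flagPerm ρ hι 0 * flagPerm ρ hι 1) ^ p = 1 := by
    refine pow_apply_of_forall (α := ι * ρ) (β := ι * (ι * ρ)⁻¹ * ι⁻¹) (fun x => rfl) (fun x => ?_)
      hf ?_
    · have h : ι * (ι * ρ)⁻¹ * ι⁻¹ = ι * ρ⁻¹ := by
        rw [mul_inv_rev, hinv, mul_assoc, mul_assoc, hι, mul_one]
      rw [h]
      rfl
    · rw [conj_pow, inv_pow, hf, inv_one, mul_one, mul_inv_cancel]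
  have h12 : (flagPerm ρ hι 1 * flagPerm ρ hι 2) ^ q = 1 :=
    pow_apply_of_forall (α := ρ⁻¹) (β := ρ) (fun x => rfl) (fun x => rfl)
      (by rw [inv_pow, hρ, inv_one]) hρ
  have h02 : (flagPerm ρ hι 0 * flagPerm ρ hι 2) ^ 2 = 1 :=
    pow_apply_of_forall (α := ι) (β := ι) (fun x => rfl) (fun x => rfl)
      (by rw [pow_two, hι]) (by rw [pow_two, hι])
  have hd : ∀ i, (flagPerm ρ hι i * flagPerm ρ hι i) ^ 1 = 1 := fun i => by
    rw [pow_one, flagPerm_mul_self]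
  intro i j
  fin_cases i <;> fin_cases j
  exacts [hd 0, h01, h02, swap _ _ _ h01, hd 1, h12, swap _ _ _ h02, swap _ _ _ h12, hd 2]

end Flags

/-! ### The group elements that belong to the darts -/

section Labels

variable {p q : ℕ} {G : Type*} [Group G]

/-- The element of the group which takes a flag at the root to a flag at `v`, where `r` stands for
the rotation around the root and `t` for the half-turn about its edge `0`. -/
def label (r t : G) : Address → G
  | root => 1
  | node v k j => label r t v * r ^ (v.base + k) * t * (r * t) ^ j

lemma pow_val_natCast {r : G} (hr : r ^ q = 1) (n : ℕ) : r ^ ((n : ZMod q)).val = r ^ n := by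
  rw [ZMod.val_natCast, ← pow_eq_pow_mod n hr]

lemma pow_val_add_one (hq : 3 < q) {r : G} (hr : r ^ q = 1) (d : ZMod q) :
    r ^ (d + 1).val = r ^ d.val * r := by
  have : NeZero q := ⟨by omega⟩
  rw [← pow_succ, ← pow_val_natCast hr (d.val + 1), Nat.cast_add_one, ZMod.natCast_zmod_val]

variable {r t : G}

/-- The step to the preceding vertex of the level multiplies the label as the reversal of its dart
should. Inside the vertices of one edge this is the definition; at the seams it amounts to closing
up the cell in question, that is, to the relation `(r * t) ^ p = 1`. -/
lemma label_pred (hp : 3 < p) (hq : 3 < q) (hr : r ^ q = 1) (ht : t * t = 1)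
    (hrt : (r * t) ^ p = 1) {v : Address} (hv : v.Valid p q) (hne : v ≠ root) :
    label r t (v.pred p q) * r ^ ((v.pred p q).outdeg q + 2) = label r t v * r * t := by
  have hA : t * r ^ (q - 1) = (r * t) ^ (p - 1) := by
    apply mul_left_cancel (a := r * t)
    rw [← pow_succ', Nat.sub_add_cancel (by omega), hrt, mul_assoc, ← mul_assoc t, ht, one_mul,
      ← pow_succ', Nat.sub_add_cancel (by omega), hr]
  have hchild : ∀ u k, (node u k 0).outdeg q + 2 = q - 1 := fun u k => by
    simp only [outdeg]; omega
  induction v with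
  | root => exact absurd rfl hne
  | node u k j ih =>
    obtain ⟨hu, hk, hj⟩ := hv
    rcases hj.lt_or_eq with hj | rfl
    · have h : (node u k (j + 1)).outdeg q + 2 = q := by simp only [outdeg]; omega
      rw [pred_of_lt hj, h, hr, mul_one, label, label, pow_succ]
      simp only [mul_assoc]
    · rcases k with _ | k
      · rw [pred_gap_zero, hchild]
        -- The cell below `node u 0 _` has a side on the level of `u`, which brings in the statement
        -- for `u` itself, except at the root.
        by_cases hr0 : u = root
        · subst hr0
          simp only [label, pred, base, outdeg, gap, zero_add, pow_zero, one_mul, mul_one]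
          apply mul_left_cancel (a := r)
          have h1 : r * (t * (r * t) ^ (p - 3) * r * t) = (r * t) ^ (p - 1) := by
            rw [show p - 1 = (p - 3 + 1) + 1 by omega, pow_succ' (r * t), pow_succ (r * t)]
            simp only [mul_assoc]
          rw [h1, ← hA, mul_assoc (r ^ _), ← mul_assoc r, ← pow_succ', Nat.sub_add_cancel (by omega),
            hr, one_mul]
        · have hm := outdeg_pos hq (u.pred p q)
          have hg : u.gap p 0 = p - 4 := by
            cases u
            · exact absurd rfl hr0
            · rfl
          have h1 : r ^ ((u.pred p q).base + ((u.pred p q).outdeg q - 1)) =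
              r ^ ((u.pred p q).outdeg q + 2) * r ^ (q - 1) := by
            have : (u.pred p q).outdeg q + 2 + (q - 1) =
              q + ((u.pred p q).base + ((u.pred p q).outdeg q - 1)) := by
              rw [base_of_ne (pred_ne_root hr0)]
              omega
            rw [← pow_add, this, pow_add _ q, hr, one_mul]
          have h2 : (r * t) ^ (p - 1) * (r * t) ^ (p - 1) = (r * t) * (r * t) ^ (p - 4) * r * t := by
            rw [← pow_add, show p - 1 + (p - 1) = p + (p - 4 + 1 + 1) by omega, pow_add, hrt,
              one_mul, pow_succ (r * t), pow_succ' (r * t)]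
            simp only [mul_assoc]
          calc label r t (node (u.pred p q) ((u.pred p q).outdeg q - 1) 0) * r ^ (q - 1)
              = label r t (u.pred p q) * r ^ ((u.pred p q).outdeg q + 2) *
                  r ^ (q - 1) * (t * r ^ (q - 1)) := by
                simp only [label, h1, pow_zero, mul_one, mul_assoc]
            _ = label r t u * r * ((t * r ^ (q - 1)) * (t * r ^ (q - 1))) := by
                rw [ih hu hr0]
                simp only [mul_assoc]
            _ = label r t (node u 0 (u.gap p 0)) * r * t := by
                rw [hA, h2, label, base_of_ne hr0, hg, add_zero, pow_two]
                simp only [mul_assoc]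
      · have hg : u.gap p (k + 1) = p - 3 := by cases u <;> rfl
        rw [pred_gap_succ, hchild, label, label, hg, mul_assoc, mul_assoc, pow_zero, one_mul, hA,
          show p - 1 = (p - 3 + 1) + 1 by omega, pow_succ (r * t), pow_succ' (r * t), ← add_assoc,
          pow_succ]
        simp only [mul_assoc]

/-- The labels are compatible with the reversal of darts. -/
lemma label_opp (hp : 3 < p) (hq : 3 < q) (hr : r ^ q = 1) (ht : t * t = 1)
    (hrt : (r * t) ^ p = 1) {v : Address} (hv : v.Valid p q) (d : ZMod q) :
    label r t (opp p q v d).1 * r ^ (opp p q v d).2.val = label r t v * r ^ d.val * t := by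
  cases kind hq v d with
  | out v k hk =>
    rw [opp_out hq hk, pow_val_natCast hr, label, ZMod.val_zero, pow_zero, pow_zero, mul_one,
      mul_one]
  | prev v h =>
    rw [opp_prev h, pow_val_natCast hr, ZMod.val_one'' (by omega), pow_one,
      label_pred hp hq hr ht hrt hv h]
  | next v h =>
    have h1 := label_pred hp hq hr ht hrt (hv.succ hq) (succ_ne_root h)
    rw [pred_succ hv] at h1
    rw [opp_next hq h, pow_val_natCast hr, h1, ZMod.val_one'' (by omega), pow_one, mul_assoc _ t,
      ht, mul_one]
  | down v k =>
    rw [opp_down hq, pow_val_natCast hr, label, ZMod.val_zero, pow_zero, pow_zero, mul_one,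
      mul_one, mul_assoc _ t, ht, mul_one]

end Labels

/-! ### The group as the set of flags -/

/-- The darts of the mosaic. -/
abbrev Dart (p q : ℕ) : Type := {x : Address × ZMod q // x.1.Valid p q}

namespace Dart

variable {p q : ℕ}

/-- The rotation of the darts around their vertices. -/
def rotation : Perm (Dart p q) where
  toFun x := ⟨(x.1.1, x.1.2 + 1), x.2⟩
  invFun x := ⟨(x.1.1, x.1.2 - 1), x.2⟩
  left_inv _ := Subtype.ext (Prod.ext rfl (add_sub_cancel_right _ _))
  right_inv _ := Subtype.ext (Prod.ext rfl (sub_add_cancel _ _))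

lemma rotation_pow (n : ℕ) (x : Dart p q) :
    (rotation ^ n) x = ⟨(x.1.1, x.1.2 + n), x.2⟩ := by
  induction n with
  | zero => exact Subtype.ext (Prod.ext rfl (by simp))
  | succ n ih =>
    rw [pow_succ', Perm.mul_apply, ih]
    exact Subtype.ext (Prod.ext rfl ((add_assoc _ _ _).trans (by rw [Nat.cast_add_one])))

lemma rotation_pow_self : (rotation : Perm (Dart p q)) ^ q = 1 := by
  ext1 x
  rw [rotation_pow, ZMod.natCast_self, add_zero]
  rfl

lemma reversal_involutive (hq : 3 < q) : Function.Involutive fun x : Dart p q =>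
    (⟨opp p q x.1.1 x.1.2, x.2.opp hq x.1.2⟩ : Dart p q) :=
  fun x => Subtype.ext (opp_opp hq x.2 x.1.2)

/-- The reversal of the darts. -/
def reversal (hq : 3 < q) : Perm (Dart p q) := (reversal_involutive hq).toPerm

lemma reversal_mul_self (hq : 3 < q) : (reversal hq : Perm (Dart p q)) * reversal hq = 1 :=
  Equiv.ext fun x => reversal_involutive hq x

/-- The permutation of the darts that runs clockwise around the cells to their left. -/
def face (hq : 3 < q) : Perm (Dart p q) := reversal hq * rotation

lemma face_pow_val (hq : 3 < q) (n : ℕ) (x : Dart p q) :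
    ((face hq ^ n) x).1 = (faceStep p q)^[n] x.1 := by
  induction n with
  | zero => rfl
  | succ n ih =>
    rw [pow_succ', Perm.mul_apply, Function.iterate_succ_apply', ← ih]
    rfl

lemma exists_face_pow (hq : 3 < q) (x : Dart p q) : ∃ (u : Address) (k : ℕ)
    (h : (node u k 0).Valid p q) (i : ℕ),
      (face hq ^ i) ⟨(node u k 0, 0), h⟩ = x := by
  obtain ⟨u, k, i, h, hi⟩ := exists_iterate_faceStep hq x.2 x.1.2
  exact ⟨u, k, h, i, Subtype.ext ((face_pow_val hq i _).trans hi)⟩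

lemma face_pow_self (hp : 3 < p) (hq : 3 < q) :
    (face hq : Perm (Dart p q)) ^ p = 1 := by
  ext1 x
  obtain ⟨u, k, h, i, rfl⟩ := exists_face_pow hq x
  have h1 : (face hq ^ p) (⟨(node u k 0, 0), h⟩ : Dart p q) =
      ⟨(node u k 0, 0), h⟩ :=
    Subtype.ext ((face_pow_val hq p _).trans (faceStep_iterate_child hp hq h))
  rw [← Perm.mul_apply, ← pow_add, add_comm, pow_add, Perm.mul_apply, h1]
  rfl

end Dart

section Group

variable {p q : ℕ} (hp : 3 < p) (hq : 3 < q)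

/-- The flag of the mosaic as an element of the group `[p,q]`; the base flag lies at the root. -/
def ofFlag : Dart p q × Bool → (schlafliMatrix p q hp.le hq.le).Group := fun x =>
  let s := (schlafliMatrix p q hp.le hq.le).simple
  label (s 1 * s 2) (s 0 * s 2) x.1.1.1 * (s 1 * s 2) ^ x.1.1.2.val * bif x.2 then 1 else s 2

lemma ofFlag_flagMap (i : Fin 3) (x : Dart p q × Bool) :
    ofFlag hp hq (flagMap Dart.rotation (Dart.reversal hq) i x) =
      ofFlag hp hq x * (schlafliMatrix p q hp.le hq.le).simple i := by
  let M := schlafliMatrix p q hp.le hq.le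
  let s := M.simple
  have hs : ∀ i, s i * s i = 1 := M.toCoxeterSystem.simple_mul_simple_self
  have h12 : (s 1 * s 2) ^ q = 1 := M.toCoxeterSystem.simple_mul_simple_pow 1 2
  have h10 : (s 1 * s 0) ^ p = 1 := M.toCoxeterSystem.simple_mul_simple_pow 1 0
  have h02 : (s 0 * s 2) ^ 2 = 1 := M.toCoxeterSystem.simple_mul_simple_pow 0 2
  have hcomm : s 2 * s 0 = s 0 * s 2 := by
    rw [pow_two] at h02
    have h := eq_inv_of_mul_eq_one_left h02
    rw [h, mul_inv_rev, inv_eq_of_mul_eq_one_left (hs 0), inv_eq_of_mul_eq_one_left (hs 2)]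
  have ht : (s 0 * s 2) * (s 0 * s 2) = 1 := by rw [← pow_two, h02]
  have hrt : ((s 1 * s 2) * (s 0 * s 2)) ^ p = 1 := by
    rw [← hcomm, mul_assoc, ← mul_assoc (s 2), hs, one_mul, h10]
  have hopp := fun x : Dart p q => label_opp hp hq h12 ht hrt x.2 x.1.2
  obtain ⟨x, ε⟩ := x
  have hrot : (s 1 * s 2) ^ (x.1.2).val =
      (s 1 * s 2) ^ (x.1.2 - 1).val * (s 1 * s 2) := by
    rw [← pow_val_add_one hq h12, sub_add_cancel]
  fin_cases i <;> cases ε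
  · change label _ _ _ * (s 1 * s 2) ^ _ * 1 = label _ _ _ * (s 1 * s 2) ^ _ * s 2 * s 0
    rw [mul_one, mul_assoc _ (s 2), hcomm]
    exact hopp x
  · change label _ _ _ * (s 1 * s 2) ^ _ * s 2 = label _ _ _ * (s 1 * s 2) ^ _ * 1 * s 0
    refine (congrArg (· * s 2) (hopp x)).trans ?_
    simp only [mul_assoc, hs, mul_one]
    rfl
  · change label _ _ _ * (s 1 * s 2) ^ (x.1.2 - 1).val * 1 =
      label _ _ _ * (s 1 * s 2) ^ x.1.2.val * s 2 * s 1
    rw [hrot]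
    simp only [mul_assoc, hs, mul_one]
    rfl
  · change label _ _ _ * (s 1 * s 2) ^ (x.1.2 + 1).val * s 2 =
      label _ _ _ * (s 1 * s 2) ^ x.1.2.val * 1 * s 1
    rw [pow_val_add_one hq h12]
    simp only [mul_assoc, hs, mul_one]
    rfl
  · change label _ _ _ * (s 1 * s 2) ^ _ * 1 = label _ _ _ * (s 1 * s 2) ^ _ * s 2 * s 2
    rw [mul_assoc _ (s 2), hs]
    rfl
  · change label _ _ _ * (s 1 * s 2) ^ _ * s 2 = label _ _ _ * (s 1 * s 2) ^ _ * 1 * s 2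
    rw [mul_one]
    rfl

/-- The base flag. -/
def baseFlag (p q : ℕ) : Dart p q × Bool := (⟨(root, 0), trivial⟩, true)

/-- The action of the group `[p,q]` on the flags. -/
def flagAction : (schlafliMatrix p q hp.le hq.le).Group →* Perm (Dart p q × Bool) :=
  (schlafliMatrix p q hp.le hq.le).toCoxeterSystem.lift
    ⟨flagPerm Dart.rotation (Dart.reversal_mul_self hq),
      flagPerm_isLiftable hp.le hq.le _ Dart.rotation_pow_self (Dart.face_pow_self hp hq)⟩

lemma flagAction_simple (i : Fin 3) (x : Dart p q × Bool) :
    flagAction hp hq ((schlafliMatrix p q hp.le hq.le).simple i) x =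
      flagMap Dart.rotation (Dart.reversal hq) i x :=
  congrArg (fun σ : Perm _ => σ x) (CoxeterSystem.lift_apply_simple
    (schlafliMatrix p q hp.le hq.le).toCoxeterSystem _ i)

lemma ofFlag_flagAction (g : (schlafliMatrix p q hp.le hq.le).Group) (x : Dart p q × Bool) :
    ofFlag hp hq (flagAction hp hq g x) = ofFlag hp hq x * g⁻¹ := by
  induction g using (schlafliMatrix p q hp.le hq.le).toCoxeterSystem.simple_induction_left with
  | one => simp
  | mul_simple_left g i ih =>
    have h := (schlafliMatrix p q hp.le hq.le).toCoxeterSystem.inv_simple i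
    rw [CoxeterMatrix.toCoxeterSystem_simple] at h ⊢
    rw [map_mul, Perm.mul_apply, flagAction_simple, ofFlag_flagMap, ih, mul_inv_rev, h, mul_assoc]

/-- A property of flags that holds for the base flag and passes to adjacent flags holds for all
flags. -/
lemma flag_induction {P : Dart p q × Bool → Prop} (h0 : P (baseFlag p q))
    (h : ∀ i x, P x → P (flagMap Dart.rotation (Dart.reversal hq) i x)) (x : Dart p q × Bool) :
    P x := by
  have : NeZero q := ⟨by omega⟩
  have hside : ∀ x ε, P (x, ε) → ∀ ε', P (x, ε') := by
    intro x ε hx ε'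
    have h2 := h 2 _ hx
    cases ε <;> cases ε' <;> first | exact hx | exact h2
  have hrev : ∀ x ε, P (x, ε) → P (Dart.reversal hq x, ε) := fun x ε hx => hside _ _ (h 0 _ hx) _
  have hrot : ∀ (n : ℕ) x ε, P (x, ε) → P ((Dart.rotation ^ n) x, ε) := by
    intro n
    induction n with
    | zero => exact fun x ε hx => hx
    | succ n ih =>
      intro x ε hx
      have h1 : P ((Dart.rotation ^ (n + 1)) x, false) := by
        rw [pow_succ', Perm.mul_apply]
        exact h 1 _ (hside _ _ (ih x ε hx) true)
      exact hside _ _ h1 _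
  have hvertex : ∀ (v : Address) (hv : v.Valid p q) d ε, P (⟨(v, d), hv⟩, ε) →
      ∀ d' ε', P (⟨(v, d'), hv⟩, ε') := by
    intro v hv d ε hx d' ε'
    have h1 := hside _ _ (hrot (d' - d).val _ _ hx) ε'
    rw [Dart.rotation_pow, ZMod.natCast_zmod_val] at h1
    simpa using h1
  have hall : ∀ (v : Address) (hv : v.Valid p q) d ε, P (⟨(v, d), hv⟩, ε) := by
    intro v
    induction v with
    | root => exact fun hv d ε => hvertex root hv 0 true h0 d ε
    | node v k j ih =>
      induction j with
      | zero =>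
        intro hv
        refine hvertex _ hv 0 true ?_
        have h1 := hrev _ _ (ih hv.1 (v.base + k : ℕ) true)
        convert h1 using 2
        exact Subtype.ext (opp_out hq hv.2.1).symm
      | succ j ihj =>
        intro hv
        have hj : j < v.gap p k := hv.2.2
        refine hvertex _ hv ((node v k (j + 1)).outdeg q + 2 : ℕ) true ?_
        have h1 := hrev _ _ (ihj ⟨hv.1, hv.2.1, hj.le⟩ 1 true)
        have h2 : opp p q (node v k j) 1 =
            (node v k (j + 1), (((node v k (j + 1)).outdeg q + 2 : ℕ) : ZMod q)) := by
          rw [opp_prev (by simp), pred_of_lt hj]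
        convert h1 using 2
        exact Subtype.ext h2.symm
  exact hall x.1.1.1 x.1.2 x.1.1.2 x.2

/-- The group `[p,q]` acts simply transitively on the flags. -/
lemma ofFlag_bijective : Function.Bijective (ofFlag hp hq) := by
  have h1 : ofFlag hp hq (baseFlag p q) = 1 := by simp [ofFlag, baseFlag, label]
  refine Function.bijective_iff_has_inverse.mpr
    ⟨fun g => flagAction hp hq g⁻¹ (baseFlag p q), fun x => ?_, fun g => ?_⟩
  · refine flag_induction hq (P := fun x => flagAction hp hq (ofFlag hp hq x)⁻¹ (baseFlag p q) = x)
      ?_ (fun i x hx => ?_) x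
    · simp [h1]
    · have h := (schlafliMatrix p q hp.le hq.le).toCoxeterSystem.inv_simple i
      rw [CoxeterMatrix.toCoxeterSystem_simple] at h
      rw [ofFlag_flagMap, mul_inv_rev, h, map_mul, Perm.mul_apply, hx, flagAction_simple]
  · rw [ofFlag_flagAction, h1, one_mul, inv_inv]

end Group

end

section

open Address Equiv

/-! ### Vertices, edges and cells in terms of addresses -/

/-- A function on a group that is invariant under right multiplication by a set of generators is
constant on the left cosets of the subgroup. -/
lemma eq_of_mk_eq {G α : Type*} [Group G] {S : Set G} {F : G → α}
    (hF : ∀ g, ∀ s ∈ S, F (g * s) = F g) {g h : G}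
    (hgh : (QuotientGroup.mk g : G ⧸ Subgroup.closure S) = QuotientGroup.mk h) : F g = F h := by
  have key : ∀ x ∈ Subgroup.closure S, ∀ g, F (g * x) = F g := by
    intro x hx
    induction hx using Subgroup.closure_induction with
    | mem x hx => exact fun g => hF g x hx
    | one => exact fun g => by rw [mul_one]
    | mul x y _ _ hx hy => exact fun g => by rw [← mul_assoc, hy, hx]
    | inv x _ hx => exact fun g => by rw [← hx (g * x⁻¹), inv_mul_cancel_right]
  have h1 := key _ (QuotientGroup.eq.mp hgh) g
  rwa [mul_inv_cancel_left, eq_comm] at h1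

variable {p q : ℕ} (hp : 3 < p) (hq : 3 < q)

/-- The flags as elements of the group, where the base flag is an arbitrary one. -/
noncomputable def flagEquiv (g₀ : (schlafliMatrix p q hp.le hq.le).Group) :
    Dart p q × Bool ≃ (schlafliMatrix p q hp.le hq.le).Group :=
  (Equiv.ofBijective _ (ofFlag_bijective hp hq)).trans (Equiv.mulLeft g₀)

variable (g₀ : (schlafliMatrix p q hp.le hq.le).Group)

lemma flagEquiv_flagMap (i : Fin 3) (x : Dart p q × Bool) :
    flagEquiv hp hq g₀ (flagMap Dart.rotation (Dart.reversal hq) i x) =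
      flagEquiv hp hq g₀ x * (schlafliMatrix p q hp.le hq.le).simple i :=
  (congrArg (g₀ * ·) (ofFlag_flagMap hp hq i x)).trans (mul_assoc _ _ _).symm

lemma flagEquiv_symm_mul (i : Fin 3) (g : (schlafliMatrix p q hp.le hq.le).Group) :
    (flagEquiv hp hq g₀).symm (g * (schlafliMatrix p q hp.le hq.le).simple i) =
      flagMap Dart.rotation (Dart.reversal hq) i ((flagEquiv hp hq g₀).symm g) := by
  rw [Equiv.symm_apply_eq, flagEquiv_flagMap, Equiv.apply_symm_apply]

/-- The address of the vertex of a flag. -/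
def flagVertex (x : Dart p q × Bool) : {v : Address // v.Valid p q} := ⟨x.1.1.1, x.1.2⟩

/-- The level of the cell of a flag. -/
def flagCellLevel (x : Dart p q × Bool) : ℕ :=
  bif x.2 then cellLevel x.1.1 else cellLevel (x.1.1.1, x.1.1.2 - 1)

lemma flagVertex_flagMap {i : Fin 3} (hi : i ≠ 0) (x : Dart p q × Bool) :
    flagVertex (flagMap Dart.rotation (Dart.reversal hq) i x) = flagVertex x := by
  obtain ⟨x, ε⟩ := x
  fin_cases i
  · exact absurd rfl hi
  · cases ε <;> rfl
  · rfl

lemma flagCellLevel_flagMap {i : Fin 3} (hi : i ≠ 2) (x : Dart p q × Bool) :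
    flagCellLevel (flagMap Dart.rotation (Dart.reversal hq) i x) = flagCellLevel x := by
  obtain ⟨⟨x, hx⟩, ε⟩ := x
  fin_cases i
  · cases ε
    · exact cellLevel_opp hq hx x.2
    · have h := cellLevel_opp hq (hx.opp hq x.2) (opp p q x.1 x.2).2
      rw [opp_opp hq hx] at h
      exact h.symm
  · cases ε
    · rfl
    · exact congrArg (fun d => cellLevel (x.1, d)) (add_sub_cancel_right _ _)
  · exact absurd rfl hi

lemma vertexOf_mul (g : (schlafliMatrix p q hp.le hq.le).Group) {i : Fin 3} (hi : i ≠ 0) :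
    vertexOf (g * (schlafliMatrix p q hp.le hq.le).simple i) = vertexOf g := by
  refine QuotientGroup.mk_mul_of_mem g (Subgroup.subset_closure ?_)
  fin_cases i <;> simp_all

lemma edgeOf_mul (g : (schlafliMatrix p q hp.le hq.le).Group) {i : Fin 3} (hi : i ≠ 1) :
    edgeOf (g * (schlafliMatrix p q hp.le hq.le).simple i) = edgeOf g := by
  refine QuotientGroup.mk_mul_of_mem g (Subgroup.subset_closure ?_)
  fin_cases i <;> simp_all

lemma cellOf_mul (g : (schlafliMatrix p q hp.le hq.le).Group) {i : Fin 3} (hi : i ≠ 2) :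
    cellOf (g * (schlafliMatrix p q hp.le hq.le).simple i) = cellOf g := by
  refine QuotientGroup.mk_mul_of_mem g (Subgroup.subset_closure ?_)
  fin_cases i <;> simp_all

lemma vertexOf_flagEquiv_rotation_pow (n : ℕ) (x : Dart p q) (ε ε' : Bool) :
    vertexOf (flagEquiv hp hq g₀ ((Dart.rotation ^ n) x, ε)) =
      vertexOf (flagEquiv hp hq g₀ (x, ε')) := by
  have hside : ∀ (x : Dart p q) (ε ε' : Bool), vertexOf (flagEquiv hp hq g₀ (x, ε)) =
      vertexOf (flagEquiv hp hq g₀ (x, ε')) := by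
    have h2 : ∀ (x : Dart p q) (ε : Bool), vertexOf (flagEquiv hp hq g₀ (x, !ε)) =
        vertexOf (flagEquiv hp hq g₀ (x, ε)) := fun x ε =>
      (congrArg vertexOf (flagEquiv_flagMap hp hq g₀ 2 (x, ε))).trans
        (vertexOf_mul hp hq _ (by decide))
    intro x ε ε'
    cases ε <;> cases ε'
    exacts [rfl, h2 x true, h2 x false, rfl]
  induction n generalizing ε with
  | zero => exact hside x ε ε'
  | succ n ih =>
    rw [← ih true, pow_succ', Perm.mul_apply, hside _ ε false]
    exact (congrArg vertexOf (flagEquiv_flagMap hp hq g₀ 1 (_, true))).trans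
        (vertexOf_mul hp hq _ (by decide))

/-- The vertex of the mosaic with a given address. -/
noncomputable def vertexAt (v : {v : Address // v.Valid p q}) :
    Vertex (schlafliMatrix p q hp.le hq.le) :=
  vertexOf (flagEquiv hp hq g₀ (⟨(v.1, 0), v.2⟩, true))

lemma vertexOf_flagEquiv (x : Dart p q × Bool) :
    vertexOf (flagEquiv hp hq g₀ x) = vertexAt hp hq g₀ (flagVertex x) := by
  have : NeZero q := ⟨by omega⟩
  obtain ⟨⟨⟨v, d⟩, hv⟩, ε⟩ := x
  have h := vertexOf_flagEquiv_rotation_pow hp hq g₀ d.val ⟨(v, 0), hv⟩ ε true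
  rw [Dart.rotation_pow, ZMod.natCast_zmod_val, zero_add] at h
  exact h

lemma flagVertex_eq {x y : Dart p q × Bool}
    (h : vertexOf (flagEquiv hp hq g₀ x) = vertexOf (flagEquiv hp hq g₀ y)) :
    flagVertex x = flagVertex y := by
  have h1 := eq_of_mk_eq (F := fun g => flagVertex ((flagEquiv hp hq g₀).symm g))
    (fun g s hs => ?_) h
  · simpa using h1
  · rcases hs with rfl | rfl <;>
    simp only [flagEquiv_symm_mul] <;> exact flagVertex_flagMap hq (by decide) _

lemma flagCellLevel_eq {x y : Dart p q × Bool}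
    (h : cellOf (flagEquiv hp hq g₀ x) = cellOf (flagEquiv hp hq g₀ y)) :
    flagCellLevel x = flagCellLevel y := by
  have h1 := eq_of_mk_eq (F := fun g => flagCellLevel ((flagEquiv hp hq g₀).symm g))
    (fun g s hs => ?_) h
  · simpa using h1
  · rcases hs with rfl | rfl <;>
    simp only [flagEquiv_symm_mul] <;> exact flagCellLevel_flagMap hq (by decide) _

/-- Two flags on the same edge have the same vertex, or the vertices are the two ends of the
edge. -/
lemma flagVertex_of_edgeOf_eq {x y : Dart p q × Bool}
    (h : edgeOf (flagEquiv hp hq g₀ x) = edgeOf (flagEquiv hp hq g₀ y)) :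
    flagVertex y = flagVertex x ∨
      (flagVertex y).1 = (opp p q x.1.1.1 x.1.1.2).1 := by
  let ends : Dart p q × Bool → Sym2 {v : Address // v.Valid p q} := fun x =>
    s(flagVertex x, flagVertex (flagMap Dart.rotation (Dart.reversal hq) 0 x))
  have h1 := eq_of_mk_eq (F := fun g => ends ((flagEquiv hp hq g₀).symm g)) (fun g s hs => ?_) h
  · simp only [Equiv.symm_apply_apply] at h1
    have h2 : flagVertex y ∈ ends x := by
      rw [h1]
      exact Sym2.mem_mk_left _ _
    exact (Sym2.mem_iff.mp h2).imp_right (congrArg Subtype.val)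
  · rcases hs with rfl | rfl
    · simp only [flagEquiv_symm_mul, ends]
      rw [flagMap_involutive _ (Dart.reversal_mul_self hq) 0, Sym2.eq_swap]
    · simp only [flagEquiv_symm_mul]
      rfl

lemma vertexAt_bijective : Function.Bijective (vertexAt hp hq g₀) := by
  refine ⟨fun v w h => flagVertex_eq hp hq g₀ h, fun w => ?_⟩
  obtain ⟨g, rfl⟩ := QuotientGroup.mk_surjective w
  obtain ⟨x, rfl⟩ := (flagEquiv hp hq g₀).surjective g
  exact ⟨flagVertex x, (vertexOf_flagEquiv hp hq g₀ x).symm⟩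

lemma lattice_adj_vertexAt (v w : {v : Address // v.Valid p q}) :
    (lattice (schlafliMatrix p q hp.le hq.le)).Adj (vertexAt hp hq g₀ v) (vertexAt hp hq g₀ w) ↔
      v ≠ w ∧ ∃ d, (opp p q v.1 d).1 = w.1 := by
  constructor
  · rintro ⟨hne, e, ⟨g, hg, rfl⟩, h, hh, he⟩
    have hvw : v ≠ w := fun h => hne (congrArg _ h)
    obtain ⟨x, rfl⟩ := (flagEquiv hp hq g₀).surjective g
    obtain ⟨y, rfl⟩ := (flagEquiv hp hq g₀).surjective h
    have hx : flagVertex x = v := flagVertex_eq hp hq g₀ hg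
    have hy : flagVertex y = w := flagVertex_eq hp hq g₀ hh
    refine ⟨hvw, x.1.1.2, ?_⟩
    rcases flagVertex_of_edgeOf_eq hp hq g₀ he.symm with h | h
    · exact absurd (hx.symm.trans (h.symm.trans hy)) hvw
    · rw [← hx, ← hy]
      exact h.symm
  · rintro ⟨hne, d, hd⟩
    refine ⟨fun h => hne ((vertexAt_bijective hp hq g₀).1 h),
      edgeOf (flagEquiv hp hq g₀ (⟨(v.1, d), v.2⟩, true)),
      ⟨_, vertexOf_flagEquiv hp hq g₀ _, rfl⟩,
      ⟨flagEquiv hp hq g₀ (flagMap Dart.rotation (Dart.reversal hq) 0 (⟨(v.1, d), v.2⟩, true)),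
        ?_, ?_⟩⟩
    · rw [vertexOf_flagEquiv]
      exact congrArg _ (Subtype.ext hd)
    · rw [flagEquiv_flagMap]
      exact edgeOf_mul hp hq _ (by decide)

lemma cellOf_flagEquiv_face_pow (n : ℕ) (x : Dart p q) :
    cellOf (flagEquiv hp hq g₀ ((Dart.face hq ^ n) x, true)) =
      cellOf (flagEquiv hp hq g₀ (x, true)) := by
  induction n with
  | zero => rfl
  | succ n ih =>
    rw [← ih, pow_succ', Perm.mul_apply]
    refine ((congrArg cellOf (flagEquiv_flagMap hp hq g₀ 0
      (Dart.rotation ((Dart.face hq ^ n) x), false))).trans (cellOf_mul hp hq _ (by decide))).trans ?_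
    exact (congrArg cellOf (flagEquiv_flagMap hp hq g₀ 1
      ((Dart.face hq ^ n) x, true))).trans (cellOf_mul hp hq _ (by decide))

lemma exists_flag_of_cell (c : Cell (schlafliMatrix p q hp.le hq.le)) :
    ∃ (u : Address) (k : ℕ) (h : (node u k 0).Valid p q),
      cellOf (flagEquiv hp hq g₀ (⟨(node u k 0, 0), h⟩, true)) = c := by
  obtain ⟨g, rfl⟩ := QuotientGroup.mk_surjective c
  obtain ⟨⟨x, ε⟩, rfl⟩ := (flagEquiv hp hq g₀).surjective g
  obtain ⟨y, hy⟩ : ∃ y, cellOf (flagEquiv hp hq g₀ (y, true)) =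
      cellOf (flagEquiv hp hq g₀ (x, ε)) := by
    cases ε
    · exact ⟨Dart.rotation⁻¹ x, (congrArg cellOf (flagEquiv_flagMap hp hq g₀ 1 (x, false))).trans
        (cellOf_mul hp hq _ (by decide))⟩
    · exact ⟨x, rfl⟩
  obtain ⟨u, k, h, i, rfl⟩ := Dart.exists_face_pow hq y
  exact ⟨u, k, h, (cellOf_flagEquiv_face_pow hp hq g₀ i _).symm.trans hy⟩

/-- The vertices of the mosaic around `o` correspond to the addresses, and every cell has a level:
its vertices lie on this level and on the level below, and it has vertices on both. -/
theorem exists_addressing (o : Vertex (schlafliMatrix p q hp.le hq.le)) :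
    ∃ e : {v : Address // v.Valid p q} ≃ Vertex (schlafliMatrix p q hp.le hq.le),
      e ⟨root, trivial⟩ = o ∧
      (∀ v w, (lattice _).Adj (e v) (e w) ↔ v ≠ w ∧ ∃ d, (opp p q v.1 d).1 = w.1) ∧
      ∃ l : Cell (schlafliMatrix p q hp.le hq.le) → ℕ,
        (∀ v c, OnCell (e v) c → l c = v.1.level ∨ l c = v.1.level + 1) ∧
        (∀ c, ∃ v, OnCell (e v) c ∧ l c = v.1.level) ∧
        (∀ c, ∃ v, OnCell (e v) c ∧ l c = v.1.level + 1) ∧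
        (∀ v, ∃ c, OnCell (e v) c ∧ l c = v.1.level + 1) ∧
        (∀ v, v.1 ≠ root → ∃ c, OnCell (e v) c ∧ l c = v.1.level) := by
  obtain ⟨g₀, rfl⟩ := QuotientGroup.mk_surjective o
  let l : Cell (schlafliMatrix p q hp.le hq.le) → ℕ := fun c =>
    flagCellLevel ((flagEquiv hp hq g₀).symm (Quotient.out c))
  have hl : ∀ x, l (cellOf (flagEquiv hp hq g₀ x)) = flagCellLevel x := fun x =>
    flagCellLevel_eq hp hq g₀ (by
      rw [Equiv.apply_symm_apply]
      exact Quotient.out_eq _)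
  refine ⟨Equiv.ofBijective _ (vertexAt_bijective hp hq g₀), ?_, lattice_adj_vertexAt hp hq g₀,
    l, ?_, ?_, ?_, ?_, ?_⟩
  · have h1 : ofFlag hp hq (baseFlag p q) = 1 := by simp [ofFlag, baseFlag, label]
    exact congrArg vertexOf ((congrArg (g₀ * ·) h1).trans (mul_one g₀))
  · rintro v _ ⟨g, hg, rfl⟩
    obtain ⟨x, rfl⟩ := (flagEquiv hp hq g₀).surjective g
    have hx : flagVertex x = v := flagVertex_eq hp hq g₀ hg
    rw [hl, ← hx]
    have h : ∀ y : Address × ZMod q, cellLevel y = y.1.level ∨ cellLevel y = y.1.level + 1 := by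
      intro y
      unfold cellLevel
      split_ifs <;> simp
    rcases x with ⟨x, _ | _⟩
    · exact h (x.1.1, x.1.2 - 1)
    · exact h x.1
  · intro c
    obtain ⟨u, k, h, rfl⟩ := exists_flag_of_cell hp hq g₀ c
    refine ⟨⟨node u k 0, h⟩, ⟨_, rfl, rfl⟩, ?_⟩
    rw [hl]
    exact if_pos ⟨by simp, Or.inl rfl⟩
  · intro c
    obtain ⟨u, k, h, rfl⟩ := exists_flag_of_cell hp hq g₀ c
    refine ⟨⟨u, h.1⟩, ⟨flagEquiv hp hq g₀ (flagMap Dart.rotation (Dart.reversal hq) 0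
      (⟨(node u k 0, 0), h⟩, true)), ?_, ?_⟩, ?_⟩
    · rw [vertexOf_flagEquiv]
      exact congrArg _ (Subtype.ext (congrArg Prod.fst (opp_down hq u k)))
    · rw [flagEquiv_flagMap]
      exact cellOf_mul hp hq _ (by decide)
    · rw [hl]
      exact if_pos ⟨by simp, Or.inl rfl⟩
  · intro v
    have hm := outdeg_pos hq v.1
    refine ⟨_, ⟨flagEquiv hp hq g₀ (⟨(v.1, 1), v.2⟩, true), vertexOf_flagEquiv hp hq g₀ _, rfl⟩, ?_⟩
    rw [hl]
    have := cellLevel_of_lt hq (v := v.1) one_pos (by omega)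
    rwa [Nat.cast_one] at this
  · intro v hv
    refine ⟨_, ⟨flagEquiv hp hq g₀ (⟨(v.1, 0), v.2⟩, true), rfl, rfl⟩, ?_⟩
    rw [hl]
    exact if_pos ⟨hv, Or.inl rfl⟩

end

section

open Address Filter Topology

/-! ### Belts and levels -/

section Belts

variable {M : CoxeterMatrix (Fin 3)} {o : Vertex M} {lev : Vertex M → ℕ} {l : Cell M → ℕ}

lemma beltVertices_eq (h0 : ∀ w, lev w = 0 ↔ w = o)
    (h1 : ∀ w c, OnCell w c → l c = lev w ∨ l c = lev w + 1)
    (h2 : ∀ c, ∃ w, OnCell w c ∧ l c = lev w)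
    (h3 : ∀ c, ∃ w, OnCell w c ∧ l c = lev w + 1)
    (h4 : ∀ w, ∃ c, OnCell w c ∧ l c = lev w + 1)
    (h5 : ∀ w, w ≠ o → ∃ c, OnCell w c ∧ l c = lev w) (n : ℕ) :
    beltVertices o n = {w | lev w = n ∨ lev w + 1 = n} := by
  have hmeets : ∀ c n, Meets c {w | lev w = n ∨ lev w + 1 = n} ↔
      l c = n + 1 ∨ l c = n ∨ l c + 1 = n := by
    intro c n
    constructor
    · rintro ⟨w, hw, hc⟩
      have := h1 w c hc
      rw [Set.mem_ofPred_eq] at hw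
      omega
    · obtain ⟨w, hw, hwl⟩ := h2 c
      obtain ⟨w', hw', hwl'⟩ := h3 c
      rintro (h | h | h)
      · exact ⟨w', Or.inl (by omega), hw'⟩
      · exact ⟨w, Or.inl (by omega), hw⟩
      · exact ⟨w, Or.inr (by omega), hw⟩
  have hvert : ∀ n, verticesOf {c | l c = n + 1} = {w | lev w = n + 1 ∨ lev w + 1 = n + 1} := by
    intro n
    ext w
    constructor
    · rintro ⟨c, hc, hw⟩
      have := h1 w c hw
      rw [Set.mem_ofPred_eq] at hc ⊢
      omega
    · rintro (h | h)
      · obtain ⟨c, hc, hl⟩ := h5 w (fun hw => by rw [(h0 w).mpr hw] at h; omega)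
        exact ⟨c, hl.trans h, hc⟩
      · obtain ⟨c, hc, hl⟩ := h4 w
        exact ⟨c, hl.trans h, hc⟩
  induction n using Nat.strong_induction_on with
  | _ n ih =>
    match n, ih with
    | 0, _ =>
      ext w
      simp [beltVertices, h0]
    | 1, _ =>
      have ho : ({o} : Set (Vertex M)) = {w | lev w = 0 ∨ lev w + 1 = 0} := by
        ext w
        simp [h0]
      rw [beltVertices, ← hvert 0, ho]
      congr 1
      ext c
      obtain ⟨w, -, hw⟩ := h3 c
      rw [Set.mem_ofPred_eq, Set.mem_ofPred_eq, hmeets]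
      omega
    | n + 2, ih =>
      rw [beltVertices, ← hvert (n + 1), ih (n + 1) (by omega), ih n (by omega)]
      congr 1
      ext c
      rw [Set.mem_ofPred_eq, Set.mem_ofPred_eq, hmeets, hmeets]
      omega

lemma layer_eq (h : ∀ n, beltVertices o n = {w | lev w = n ∨ lev w + 1 = n}) (n : ℕ) :
    layer o n = {w | lev w = n} := by
  ext w
  rw [layer, h, h, Set.mem_inter_iff, Set.mem_ofPred_eq, Set.mem_ofPred_eq, Set.mem_ofPred_eq]
  omega

/-! ### The trees -/

/-- The graph of all edges of the mosaic between consecutive levels. -/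
def levelGraph (lev : Vertex M → ℕ) : SimpleGraph (Vertex M) where
  Adj u v := (lattice M).Adj u v ∧ (lev v = lev u + 1 ∨ lev u = lev v + 1)
  symm := ⟨fun _ _ h => ⟨h.1.symm, h.2.symm⟩⟩
  loopless := ⟨fun _ h => (lattice M).loopless.irrefl _ h.1⟩

variable (hlayer : ∀ n, layer o n = {w | lev w = n})
  (hparent : ∀ u u' v, (lattice M).Adj u v → lev v = lev u + 1 → (lattice M).Adj u' v →
    lev v = lev u' + 1 → u = u')
  (hchild : ∀ u, ∃ v, (lattice M).Adj u v ∧ lev v = lev u + 1)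
include hlayer

lemma mem_links_levelGraph {i : ℕ} {u v : Vertex M} : (u, v) ∈ links o (levelGraph lev) i ↔
    lev u = i ∧ (lattice M).Adj u v ∧ lev v = lev u + 1 := by
  simp only [links, hlayer, levelGraph, Set.mem_ofPred_eq]
  constructor
  · rintro ⟨h1, h2, h3, -⟩
    exact ⟨h1, h3, by omega⟩
  · rintro ⟨h1, h2, h3⟩
    exact ⟨h1, by omega, h2, Or.inl h3⟩

lemma links_subset {T : SimpleGraph (Vertex M)} (hT : IsLayered o T) (i : ℕ) :
    links o T i ⊆ links o (levelGraph lev) i := by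
  rintro ⟨u, v⟩ ⟨h1, h2, h3⟩
  refine (mem_links_levelGraph hlayer).mpr ?_
  simp only [hlayer, Set.mem_ofPred_eq] at h1 h2
  exact ⟨h1, hT.le_lattice h3, by omega⟩

include hparent hchild

/-- Every vertex has at most one neighbour on the previous level, so that all edges between
consecutive levels can be used. -/
lemma levelGraph_isForest : IsForest o (levelGraph lev) where
  le_lattice _ _ h := h.1
  consecutive u v h := by
    rcases h.2 with h' | h'
    · exact ⟨lev u, Or.inl ((mem_links_levelGraph hlayer).mpr ⟨rfl, h.1, h'⟩)⟩
    · exact ⟨lev v, Or.inr ((mem_links_levelGraph hlayer).mpr ⟨rfl, h.1.symm, h'⟩)⟩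
  parent_unique i u u' v h h' := by
    rw [mem_links_levelGraph hlayer] at h h'
    exact hparent u u' v h.2.1 h.2.2 h'.2.1 h'.2.2
  no_leaves i u hu := by
    obtain ⟨v, h, h'⟩ := hchild u
    rw [hlayer] at hu
    exact ⟨v, (mem_links_levelGraph hlayer).mpr ⟨hu, h, h'⟩⟩
  maximum T hT i := Set.encard_le_encard (links_subset hlayer hT i)

lemma nonRoots_eq (hfin : ∀ n, {w | lev w = n}.Finite) {T : SimpleGraph (Vertex M)}
    (hT : IsForest o T) (i : ℕ) :
    nonRoots o T i = {v | lev v = i ∧ ∃ u, (lattice M).Adj u v ∧ lev v = lev u + 1} := by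
  have hlinks : ∀ j, links o T j = links o (levelGraph lev) j := fun j => by
    refine Set.Finite.eq_of_subset_of_encard_le ?_ (links_subset hlayer hT.toIsLayered j)
      (hT.maximum _ (levelGraph_isForest hlayer hparent hchild).toIsLayered j)
    refine ((hfin j).prod (hfin (j + 1))).subset ?_
    rintro ⟨u, v⟩ ⟨hu, hv, -⟩
    rw [hlayer] at hu hv
    exact ⟨hu, hv⟩
  ext v
  simp only [nonRoots, hlinks, hlayer, Set.mem_ofPred_eq, mem_links_levelGraph hlayer]
  constructor
  · rintro ⟨hv, j, -, u, -, h⟩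
    exact ⟨hv, u, h⟩
  · rintro ⟨hv, u, h, h'⟩
    exact ⟨hv, lev u, by omega, u, rfl, h, h'⟩

end Belts

/-! ### Counting addresses -/

namespace Address

variable {p q : ℕ}

/-- The valid addresses of level `n`. -/
def levelFinset (p q : ℕ) : ℕ → Finset Address
  | 0 => {root}
  | n + 1 => ((levelFinset p q n).sigma fun v => (Finset.range (v.outdeg q)).sigma fun k =>
      Finset.range (v.gap p k + 1)).map
        ⟨fun x : (_ : Address) × (_ : ℕ) × ℕ => node x.1 x.2.1 x.2.2, by
          rintro ⟨v, k, j⟩ ⟨v', k', j'⟩ h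
          simpa using h⟩

lemma mem_levelFinset {n : ℕ} {v : Address} :
    v ∈ levelFinset p q n ↔ v.Valid p q ∧ v.level = n := by
  induction n generalizing v with
  | zero => cases v <;> simp [levelFinset, Valid, level]
  | succ n ih =>
    cases v with
    | root => simp [levelFinset, level]
    | node v k j =>
      simp only [levelFinset, Finset.mem_map, Finset.mem_sigma, Finset.mem_range, ih,
        Valid, level, Nat.lt_succ_iff]
      constructor
      · rintro ⟨⟨v, k, j⟩, ⟨⟨h1, h2⟩, h3, h4⟩, h⟩
        cases h
        exact ⟨⟨h1, h3, h4⟩, congrArg (· + 1) h2⟩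
      · rintro ⟨⟨h1, h3, h4⟩, h2⟩
        exact ⟨⟨v, k, j⟩, ⟨⟨h1, Nat.succ_injective h2⟩, h3, h4⟩, rfl⟩

/-- The vertex is joined to the previous level. -/
def IsEnd : Address → Prop
  | root => False
  | node _ _ j => j = 0

instance : DecidablePred IsEnd
  | root => inferInstanceAs (Decidable False)
  | node _ _ j => inferInstanceAs (Decidable (j = 0))

variable (p q) in
/-- The number of vertices on level `n` that are joined to the previous level. -/
def endCount (n : ℕ) : ℕ := ((levelFinset p q n).filter IsEnd).card

variable (p q) in
/-- The number of vertices on level `n` that are not joined to the previous level. -/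
def otherCount (n : ℕ) : ℕ := ((levelFinset p q n).filter (¬ IsEnd ·)).card

lemma endCount_add_otherCount (n : ℕ) :
    endCount p q n + otherCount p q n = (levelFinset p q n).card :=
  Finset.card_filter_add_card_filter_not _

lemma endCount_succ_eq_sum (n : ℕ) :
    endCount p q (n + 1) = ∑ v ∈ levelFinset p q n, v.outdeg q := by
  have h : (levelFinset p q (n + 1)).filter IsEnd =
      ((levelFinset p q n).sigma fun v => Finset.range (v.outdeg q)).map
        ⟨fun x : (_ : Address) × ℕ => node x.1 x.2 0, by
          rintro ⟨v, k⟩ ⟨v', k'⟩ h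
          simpa using h⟩ := by
    ext v
    cases v with
    | root => simp [IsEnd]
    | node v k j =>
      simp only [Finset.mem_filter, mem_levelFinset, Finset.mem_map, Finset.mem_sigma,
        Finset.mem_range, Valid, level, IsEnd]
      constructor
      · rintro ⟨⟨⟨h1, h2, -⟩, h3⟩, rfl⟩
        exact ⟨⟨v, k⟩, ⟨⟨h1, Nat.succ_injective h3⟩, h2⟩, rfl⟩
      · rintro ⟨⟨v, k⟩, ⟨⟨h1, h2⟩, h3⟩, h⟩
        cases h
        exact ⟨⟨⟨h1, h3, Nat.zero_le _⟩, congrArg (· + 1) h2⟩, rfl⟩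
  rw [endCount, h, Finset.card_map, Finset.card_sigma]
  simp

lemma card_levelFinset_succ (n : ℕ) : (levelFinset p q (n + 1)).card =
    ∑ v ∈ levelFinset p q n, ∑ k ∈ Finset.range (v.outdeg q), (v.gap p k + 1) := by
  rw [levelFinset, Finset.card_map, Finset.card_sigma]
  simp [Finset.card_sigma]

lemma endCount_one : endCount p q 1 = q := by
  rw [endCount_succ_eq_sum]
  simp [levelFinset, outdeg]

lemma otherCount_one : otherCount p q 1 = q * (p - 3) := by
  have h := endCount_add_otherCount (p := p) (q := q) 1
  rw [endCount_one, card_levelFinset_succ] at h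
  simp only [levelFinset, outdeg, gap, Finset.sum_singleton, Finset.sum_const, Finset.card_range,
    smul_eq_mul, mul_add] at h
  omega

lemma ne_root_of_mem {n : ℕ} {v : Address} (h : v ∈ levelFinset p q (n + 1)) : v ≠ root := by
  rintro rfl
  simpa [level] using (mem_levelFinset.mp h).2

lemma endCount_succ (n : ℕ) : endCount p q (n + 2) =
    (q - 3) * endCount p q (n + 1) + (q - 2) * otherCount p q (n + 1) := by
  rw [endCount_succ_eq_sum, ← Finset.sum_filter_add_sum_filter_not _ IsEnd, endCount, otherCount,
    mul_comm (q - 3), mul_comm (q - 2), ← smul_eq_mul, ← smul_eq_mul]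
  congr 1 <;> refine Finset.sum_const_nat fun v hv => ?_ <;>
    rw [Finset.mem_filter] at hv <;> rcases v with _ | ⟨v, k, _ | j⟩
  · exact absurd hv.2 id
  · rfl
  · exact absurd hv.2 (Nat.succ_ne_zero j)
  · exact absurd rfl (ne_root_of_mem hv.1)
  · exact absurd rfl hv.2
  · rfl

/-- Between the ends of consecutive edges to the next level there are `p - 3` further vertices,
except that there is one less where the edges start at different vertices. -/
lemma card_levelFinset_add (hp : 3 < p) (hq : 3 < q) (n : ℕ) :
    (levelFinset p q (n + 2)).card + (levelFinset p q (n + 1)).card =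
      (p - 2) * endCount p q (n + 2) := by
  rw [card_levelFinset_succ, Finset.card_eq_sum_ones, ← Finset.sum_add_distrib,
    endCount_succ_eq_sum, Finset.mul_sum]
  refine Finset.sum_congr rfl fun v hv => ?_
  obtain ⟨m, hm⟩ := Nat.exists_eq_add_of_lt (outdeg_pos hq v)
  rcases v with _ | ⟨v, k, j⟩
  · exact absurd rfl (ne_root_of_mem hv)
  · rw [hm, zero_add, Finset.sum_range_succ']
    simp only [gap, Finset.sum_const, Finset.card_range, smul_eq_mul]
    obtain ⟨r, rfl⟩ := Nat.exists_eq_add_of_lt hp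
    rw [show 3 + r + 1 - 3 + 1 = r + 2 by omega, show 3 + r + 1 - 4 = r by omega,
      show 3 + r + 1 - 2 = r + 2 by omega]
    ring

end Address

/-! ### Limits and eigenvalues -/

lemma tendsto_ratio {x : ℕ → ℝ} {c : ℝ} (hc : 2 < c) (hx : ∀ n, x (n + 2) = c * x (n + 1) - x n)
    (h0 : 0 < x 0) (h1 : x 0 ≤ x 1) :
    Tendsto (fun n => x (n + 1) / x n) atTop (𝓝 ((c + √(c ^ 2 - 4)) / 2)) := by
  have hs : √(c ^ 2 - 4) ^ 2 = c ^ 2 - 4 := Real.sq_sqrt (by nlinarith)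
  have hs0 : 0 ≤ √(c ^ 2 - 4) := Real.sqrt_nonneg _
  set s := √(c ^ 2 - 4)
  set z := (c + s) / 2 with hz
  set w := (c - s) / 2 with hw
  have hzw : z * w = 1 := by
    rw [hz, hw]
    linear_combination -hs / 4
  have hsum : z + w = c := by rw [hz, hw]; ring
  have hz1 : 1 < z := by rw [hz]; linarith
  have hw0 : 0 < w := by
    by_contra h
    nlinarith
  have hw1 : w < 1 := by nlinarith
  have hmono : ∀ n, 0 < x n ∧ x n ≤ x (n + 1) := by
    intro n
    induction n with
    | zero => exact ⟨h0, h1⟩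
    | succ n ih => exact ⟨by linarith, by rw [hx]; nlinarith⟩
  have hge : ∀ n, x 0 ≤ x n := by
    intro n
    induction n with
    | zero => exact le_rfl
    | succ n ih => exact ih.trans (hmono n).2
  have hd : ∀ n, x (n + 1) - z * x n = w ^ n * (x 1 - z * x 0) := by
    intro n
    induction n with
    | zero => simp
    | succ n ih =>
      rw [pow_succ', mul_assoc, ← ih, hx, ← hsum]
      linear_combination hzw * x n
  have hlim : Tendsto (fun n => w ^ n * (x 1 - z * x 0) / x n) atTop (𝓝 0) := by
    have h2 : Tendsto (fun n => w ^ n * (|x 1 - z * x 0| / x 0)) atTop (𝓝 0) := by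
      simpa using (tendsto_pow_atTop_nhds_zero_of_lt_one hw0.le hw1).mul_const
        (|x 1 - z * x 0| / x 0)
    refine squeeze_zero_norm (fun n => ?_) h2
    rw [Real.norm_eq_abs, abs_div, abs_mul, abs_of_pos (pow_pos hw0 n), abs_of_pos (hmono n).1,
      mul_div_assoc]
    have := hge n
    gcongr
  have h3 := hlim.const_add z
  rw [add_zero] at h3
  refine h3.congr fun n => ?_
  rw [← hd, sub_div, mul_div_cancel_right₀ _ (hmono n).1.ne']
  ring

lemma two_lt_c {p q : ℕ} (hp : 3 < p) (hq : 3 < q) (h : 4 < (p - 2) * (q - 2)) : 2 < c p q := by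
  have h' : ((4 : ℕ) : ℝ) < ((p - 2) * (q - 2) : ℕ) := Nat.cast_lt.mpr h
  rw [Nat.cast_mul, Nat.cast_sub (by omega), Nat.cast_sub (by omega)] at h'
  push_cast at h'
  rw [c]
  linarith

lemma hasEigenvalue_recursionMatrix {p q : ℕ} (hq : 3 < q) (x : ℝ) :
    Module.End.HasEigenvalue (Matrix.toLin' (recursionMatrix p q)) x ↔
      x ^ 2 - c p q * x + 1 = 0 := by
  have hq2 : (q : ℝ) - 2 ≠ 0 := by
    have : (3 : ℝ) < q := by exact_mod_cast hq
    linarith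
  constructor
  · intro h
    obtain ⟨v, hv⟩ := h.exists_hasEigenvector
    have h1 := hv.apply_eq_smul
    have e0 := congrFun h1 0
    have e1 := congrFun h1 1
    simp only [recursionMatrix, Matrix.toLin'_apply, Matrix.mulVec, dotProduct, Fin.sum_univ_two,
      Matrix.of_apply, Matrix.cons_val_zero, Matrix.cons_val_one, Pi.smul_apply, smul_eq_mul] at e0 e1
    have hv0 : v 0 ≠ 0 ∨ v 1 ≠ 0 := by
      by_contra! h
      refine hv.2 (funext fun i => ?_)
      fin_cases i
      exacts [h.1, h.2]
    rw [c]
    rcases hv0 with h | h <;> apply mul_right_cancel₀ h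
    · linear_combination (((q : ℝ) - 2) * (p - 3) - 1 - x) * e0 - ((q : ℝ) - 2) * e1
    · linear_combination ((q : ℝ) - 3 - x) * e1 - (((q : ℝ) - 3) * (p - 3) - 1) * e0
  · intro h
    refine Module.End.hasEigenvalue_of_hasEigenvector (x := ![(q : ℝ) - 2, x - (q - 3)]) ⟨?_, ?_⟩
    · rw [Module.End.mem_eigenspace_iff]
      rw [c] at h
      ext i
      fin_cases i
      · simp [recursionMatrix, Matrix.mulVec, dotProduct, Fin.sum_univ_two]
        ring
      · simp [recursionMatrix, Matrix.mulVec, dotProduct, Fin.sum_univ_two]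
        linear_combination -h
    · intro h0
      exact hq2 (congrFun h0 0)

lemma isGreatest_eigenvalue {p q : ℕ} (hp : 3 < p) (hq : 3 < q)
    (h : 4 < (p - 2) * (q - 2)) :
    IsGreatest {x : ℝ | Module.End.HasEigenvalue (Matrix.toLin' (recursionMatrix p q)) x}
      (z₁ p q) := by
  have hc := two_lt_c hp hq h
  have hs : √((c p q) ^ 2 - 4) ^ 2 = (c p q) ^ 2 - 4 := Real.sq_sqrt (by nlinarith)
  have hs0 : 0 ≤ √((c p q) ^ 2 - 4) := Real.sqrt_nonneg _
  refine ⟨(hasEigenvalue_recursionMatrix hq _).mpr ?_, fun x hx => ?_⟩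
  · rw [z₁]
    linear_combination hs / 4
  · have hx := (hasEigenvalue_recursionMatrix hq x).mp hx
    have h1 : (2 * x - c p q) ^ 2 ≤ √((c p q) ^ 2 - 4) ^ 2 := by
      rw [hs]
      linarith
    have := abs_le_of_sq_le_sq' h1 hs0
    rw [z₁]
    linarith [this.2]

end

section

open Address Filter Topology

variable {p q : ℕ}

/-! ### The trees in terms of addresses -/

lemma level_opp_eq (hq : 3 < q) {v w : Address} {d : ZMod q} (hd : (opp p q v d).1 = w)
    (hl : w.level = v.level + 1) : ∃ k, w = node v k 0 := by
  subst hd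
  cases kind hq v d with
  | out v k hk => exact ⟨k, by rw [opp_out hq hk]⟩
  | prev v h => rw [opp_prev h, level_pred] at hl; omega
  | next v h => rw [opp_next hq h, level_succ] at hl; omega
  | down v k => rw [opp_down hq] at hl; simp only [level] at hl; omega

/-- The levels around a vertex are finite, the trees exist, and for all choices of the trees the
numbers `a_i` and `b_i` count addresses. -/
theorem levels_and_trees (hp : 3 < p) (hq : 3 < q)
    (o : Vertex (schlafliMatrix p q hp.le hq.le)) :
    (∀ i, (layer o i).Finite) ∧ (∃ T, IsForest o T) ∧
      ∀ T, IsForest o T → ∀ i, a o T i = endCount p q i ∧ b o T i = otherCount p q i := by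
  obtain ⟨e, he0, hadj, l, h1, h2, h3, h4, h5⟩ := exists_addressing hp hq o
  let f : Vertex (schlafliMatrix p q hp.le hq.le) → Address := fun w => (e.symm w).1
  have hf : Function.Injective f := Subtype.val_injective.comp e.symm.injective
  have hfe : ∀ v, f (e v) = v.1 := fun v => congrArg Subtype.val (e.symm_apply_apply v)
  have hvalid : ∀ w, (f w).Valid p q := fun w => (e.symm w).2
  have hex : ∀ v : Address, v.Valid p q → ∃ w, f w = v := fun v hv => ⟨e ⟨v, hv⟩, hfe _⟩
  have hroot : ∀ w, f w = root ↔ w = o := fun w => by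
    rw [← he0, ← hf.eq_iff, hfe]
  have hedge : ∀ u w, ((lattice _).Adj u w ∧ (f w).level = (f u).level + 1) ↔
      ∃ k, f w = node (f u) k 0 := by
    intro u w
    have h := hadj (e.symm u) (e.symm w)
    rw [Equiv.apply_symm_apply, Equiv.apply_symm_apply] at h
    rw [h]
    constructor
    · rintro ⟨⟨-, d, hd⟩, hl⟩
      exact level_opp_eq hq hd hl
    · rintro ⟨k, hk⟩
      have hv : (node (f u) k 0).Valid p q := hk ▸ hvalid w
      have hl : (f w).level = (f u).level + 1 := by rw [hk, level]
      refine ⟨⟨fun huw => ?_, (f u).base + k, ?_⟩, hl⟩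
      · have : f u = f w := congrArg Subtype.val huw
        rw [this] at hl
        omega
      · have := congrArg Prod.fst (opp_out (p := p) hq hv.2.1)
        rw [Nat.cast_add] at this
        exact this.trans hk.symm
  have hlayer : ∀ n, layer o n = {w | (f w).level = n} := by
    refine layer_eq (beltVertices_eq (lev := fun w => (f w).level) (l := l) ?_ ?_ ?_ ?_ ?_ ?_)
    · intro w
      rw [← hroot]
      cases f w <;> simp [level]
    · intro w c hc
      exact h1 (e.symm w) c (by rwa [Equiv.apply_symm_apply])
    · intro c
      obtain ⟨v, hv, hl⟩ := h2 c
      exact ⟨e v, hv, by rw [hfe, hl]⟩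
    · intro c
      obtain ⟨v, hv, hl⟩ := h3 c
      exact ⟨e v, hv, by rw [hfe, hl]⟩
    · intro w
      obtain ⟨c, hc, hl⟩ := h4 (e.symm w)
      exact ⟨c, by rwa [Equiv.apply_symm_apply] at hc, hl⟩
    · intro w hw
      obtain ⟨c, hc, hl⟩ := h5 (e.symm w) (fun h => hw ((hroot w).mp h))
      exact ⟨c, by rwa [Equiv.apply_symm_apply] at hc, hl⟩
  have hpre : ∀ n, {w | (f w).level = n} = f ⁻¹' ↑(levelFinset p q n) := by
    intro n
    ext w
    simp [mem_levelFinset, hvalid]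
  have hfin : ∀ n, {w | (f w).level = n}.Finite := fun n => by
    rw [hpre]
    exact (Finset.finite_toSet _).preimage hf.injOn
  have hparent : ∀ u u' v, (lattice _).Adj u v → (f v).level = (f u).level + 1 →
      (lattice _).Adj u' v → (f v).level = (f u').level + 1 → u = u' := by
    intro u u' v ha hl ha' hl'
    obtain ⟨k, hk⟩ := (hedge u v).mp ⟨ha, hl⟩
    obtain ⟨k', hk'⟩ := (hedge u' v).mp ⟨ha', hl'⟩
    rw [hk] at hk'
    exact hf (Address.node.inj hk').1
  have hchild : ∀ u, ∃ v, (lattice _).Adj u v ∧ (f v).level = (f u).level + 1 := by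
    intro u
    obtain ⟨w, hw⟩ := hex (node (f u) 0 0) ⟨hvalid u, outdeg_pos hq _, Nat.zero_le _⟩
    exact ⟨w, (hedge u w).mpr ⟨0, hw⟩⟩
  refine ⟨fun i => by rw [hlayer]; exact hfin i, ⟨_, levelGraph_isForest hlayer hparent hchild⟩,
    fun T hT i => ?_⟩
  have hnon : nonRoots o T i = f ⁻¹' ↑((levelFinset p q i).filter IsEnd) := by
    rw [nonRoots_eq hlayer hparent hchild hfin hT]
    ext w
    rw [Set.mem_ofPred_eq, Set.mem_preimage, Finset.coe_filter, Set.mem_ofPred_eq, mem_levelFinset]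
    simp only [hvalid, true_and]
    refine and_congr_right fun _ => ?_
    constructor
    · rintro ⟨u, hu⟩
      obtain ⟨k, hk⟩ := (hedge u w).mp hu
      rw [hk]
      rfl
    · intro hend
      have hw := hvalid w
      rcases hfw : f w with _ | ⟨v, k, j⟩
      · rw [hfw] at hend
        exact absurd hend id
      · rw [hfw] at hend hw
        obtain rfl : j = 0 := hend
        obtain ⟨u, hu⟩ := hex v hw.1
        have := (hedge u w).mpr ⟨k, by rw [hfw, hu]⟩
        rw [hfw] at this
        exact ⟨u, this⟩
  have hroots : roots o T i = f ⁻¹' ↑((levelFinset p q i).filter (¬ IsEnd ·)) := by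
    rw [roots, hnon, hlayer, hpre, ← Set.preimage_sdiff]
    congr 1
    ext v
    simp only [Set.mem_sdiff, Finset.mem_coe, Finset.mem_filter]
    tauto
  have hcard : ∀ s : Finset Address, s ⊆ levelFinset p q i → (f ⁻¹' ↑s).ncard = s.card := by
    intro s hs
    rw [Set.ncard_preimage_of_injective_subset_range hf, Set.ncard_coe_finset]
    exact fun v hv => hex v (mem_levelFinset.mp (hs hv)).1
  exact ⟨by rw [a, hnon, hcard _ (Finset.filter_subset _ _), endCount],
    by rw [b, hroots, hcard _ (Finset.filter_subset _ _), otherCount]⟩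

/-- The growth of the sequences with the recursion matrix, for starting values from level `1`. -/
lemma tendsto_ratio_of_recursion (hp : 3 < p) (hq : 3 < q) (hyperbolic : 4 < (p - 2) * (q - 2))
    {x y : ℕ → ℝ} (hx : ∀ n, x (n + 1) = (q - 3) * x n + (q - 2) * y n)
    (hy : ∀ n, y (n + 1) + y n = (p - 3) * x (n + 1) - x n) (hx0 : 0 < x 0) (hy0 : 0 < y 0) :
    Tendsto (fun n => x (n + 1) / x n) atTop (𝓝 (z₁ p q)) ∧
      Tendsto (fun n => y (n + 1) / y n) atTop (𝓝 (z₁ p q)) ∧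
      Tendsto (fun n => (x (n + 1) + y (n + 1)) / (x n + y n)) atTop (𝓝 (z₁ p q)) := by
  have hp' : (4 : ℝ) ≤ p := by exact_mod_cast hp
  have hq' : (4 : ℝ) ≤ q := by exact_mod_cast hq
  have hx1 : x 0 + 2 * y 0 ≤ x 1 := by rw [hx]; nlinarith
  have hy1 : y 0 ≤ y 1 := by
    have h1 := hy 0
    rw [zero_add] at h1
    nlinarith
  -- The characteristic polynomial of the recursion matrix is `X ^ 2 - c * X + 1`.
  have hxr : ∀ n, x (n + 2) = c p q * x (n + 1) - x n := by
    intro n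
    rw [c]
    linear_combination hx (n + 1) + hx n + (q - 2 : ℝ) * hy n
  have hyr : ∀ n, y (n + 2) = c p q * y (n + 1) - y n := by
    intro n
    have h := hxr n
    rw [c] at h ⊢
    linear_combination hy (n + 1) + ((p : ℝ) - 3) * h + hy n +
      ((p : ℝ) - 2) * hx (n + 1) - ((p : ℝ) - 2) * h
  have hc := two_lt_c hp hq hyperbolic
  refine ⟨tendsto_ratio hc hxr hx0 (by linarith), tendsto_ratio hc hyr hy0 hy1,
    tendsto_ratio (x := fun n => x n + y n) hc (fun n => ?_) (by linarith) (by linarith)⟩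
  simp only [hxr, hyr]
  ring

end

end Mosaic

open Mosaic Filter in
theorem theorem1 (p q : ℕ) (hp : 3 < p) (hq : 3 < q) (hyperbolic : 4 < (p - 2) * (q - 2))
    (o : Mosaic.Vertex (schlafliMatrix p q hp.le hq.le)) :
    -- the levels are finite, and the trees can be built
    (∀ i, (Mosaic.layer o i).Finite) ∧
    (∃ T, Mosaic.IsForest o T) ∧
    -- the growing ratios
    (∀ T, Mosaic.IsForest o T →
      Filter.Tendsto (fun i => (Mosaic.a o T (i + 1) : ℝ) / (Mosaic.a o T i : ℝ))
        Filter.atTop (nhds (Mosaic.z₁ p q)) ∧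
      Filter.Tendsto (fun i => (Mosaic.b o T (i + 1) : ℝ) / (Mosaic.b o T i : ℝ))
        Filter.atTop (nhds (Mosaic.z₁ p q)) ∧
      Filter.Tendsto
        (fun i => ((Mosaic.a o T (i + 1) : ℝ) + (Mosaic.b o T (i + 1) : ℝ)) /
          ((Mosaic.a o T i : ℝ) + (Mosaic.b o T i : ℝ)))
        Filter.atTop (nhds (Mosaic.z₁ p q))) ∧
    -- the common limit is the largest eigenvalue of the recursion matrix
    IsGreatest {x : ℝ | Module.End.HasEigenvalue
      (Matrix.toLin' (Mosaic.recursionMatrix p q)) x} (Mosaic.z₁ p q) := by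
  obtain ⟨hfin, hforest, hcount⟩ := levels_and_trees hp hq o
  refine ⟨hfin, hforest, fun T hT => ?_, isGreatest_eigenvalue hp hq hyperbolic⟩
  have ha : ∀ i, (a o T i : ℝ) = Address.endCount p q i := fun i => by rw [(hcount T hT i).1]
  have hb : ∀ i, (b o T i : ℝ) = Address.otherCount p q i := fun i => by rw [(hcount T hT i).2]
  simp only [ha, hb]
  -- The recursion starts at level `1`: the root has more edges than the other vertices.
  have hlim := tendsto_ratio_of_recursion hp hq hyperbolic
    (x := fun n => (Address.endCount p q (n + 1) : ℝ))
    (y := fun n => (Address.otherCount p q (n + 1) : ℝ)) (fun n => ?_) (fun n => ?_) ?_ ?_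
  · exact ⟨(tendsto_add_atTop_iff_nat 1).mp hlim.1, (tendsto_add_atTop_iff_nat 1).mp hlim.2.1,
      (tendsto_add_atTop_iff_nat 1).mp hlim.2.2⟩
  · have h := congrArg (Nat.cast : ℕ → ℝ) (Address.endCount_succ (p := p) (q := q) n)
    push_cast [Nat.cast_sub hq.le, Nat.cast_sub (show 2 ≤ q by omega)] at h
    exact h
  · have h := Address.card_levelFinset_add hp hq n
    rw [← Address.endCount_add_otherCount, ← Address.endCount_add_otherCount] at h
    have h := congrArg (Nat.cast : ℕ → ℝ) h
    push_cast [Nat.cast_sub (show 2 ≤ p by omega)] at h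
    linear_combination h
  · rw [Nat.cast_pos, Address.endCount_one]
    omega
  · rw [Nat.cast_pos, Address.otherCount_one]
    exact Nat.mul_pos (by omega) (by omega)
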